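/- Consider the $M|D|\infty$ queue with catastrophes: there are infinitely many servers; customers arrive in a Poisson process of rate $\lambda>0$; each customer starts service at once, and every service time equals a constant $b\ge 0$; independently, catastrophes arrive in a Poisson process of rate $\nu\ge 0$ (no catastrophes if $\nu=0$). A catastrophe removes all customers present, and has no effect if the system is empty. The system is empty at time $0$. Let $P_0(t)$ be the probability that it is empty at time $t$, and $\tilde P_0(s)=\int_0^\infty e^{-st}P_0(t)\,dt$. Let $\pi$ be the length of the busy period, which begins when a customer arrives at the empty system and ends when the system next is free of customers, and let the busy cycle $\omega$ be the sum of the (first) idle period and the busy period that follows it. Write $\hat\pi(s)=E e^{-s\pi}$ and $\hat\omega(s)=Ee^{-s\omega}$. Then: 1. For every complex $s$ with $\operatorname{Re}s>0$ the integral defining $\tilde P_0(s)$ converges absolutely, and $$\tilde P_0(s)=\frac{\lambda+(s+\nu)e^{(\lambda+s+\nu)b}}{s(\lambda+s+\nu)e^{(\lambda+s+\nu)b}},\qquad \lim_{s\to0,\ \operatorname{Re}s>0}s\tilde P_0(s)=\frac{\nu+\lambda e^{-(\lambda+\nu)b}}{\nu+\lambda}.$$ 2. The busy period is almost surely finite,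 and for every complex $s$ with $\operatorname{Re}s\ge0$ $$\hat\pi(s)=\frac{\lambda+s+\nu e^{(\lambda+s+\nu)b}}{\lambda+(s+\nu)e^{(\lambda+s+\nu)b}},\qquad \hat\omega(s)=1-\frac{s(\lambda+s+\nu)e^{(\lambda+s+\nu)b}}{(\lambda+s)\left(\lambda+(\nu+s)e^{(\lambda+s+\nu)b}\right)}.$$ 3. The first two moments of the busy period are finite, and $$E\pi=\frac{e^{(\lambda+\nu)b}-1}{\lambda+\nu e^{(\lambda+\nu)b}},\qquad E\pi^2=\frac{2\left[1-(1+b(\lambda+\nu))e^{-(\lambda+\nu)b}\right]}{\left[\nu+\lambda e^{-(\lambda+\nu)b}\right]^2}.$$ -/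

import Mathlib

open MeasureTheory ProbabilityTheory Filter Topology

namespace MDInf

/-- The `n`-th epoch (`n = 0, 1, …`) of the point process on the half-line whose successive gaps,
counted from time `0`, are `G 0, G 1, …`. -/
def epoch {Ω : Type*} (G : ℕ → Ω → ℝ) (n : ℕ) (w : Ω) : ℝ :=
  ∑ i ∈ Finset.range (n + 1), G i w

/-- The random data driving the queue: customers arrive in a Poisson process of rate `lam > 0`
(i.i.d. exponential gaps `X 0, X 1, …`), catastrophes in an independent Poisson process of rate
`nu ≥ 0` (i.i.d. exponential gaps `Y 0, Y 1, …` if `nu > 0`; for `nu = 0` there are no catastrophes,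
see `catastropheTimes`, and the law of `Y` is irrelevant). -/
structure IsPoissonInput {Ω : Type*} [MeasurableSpace Ω] (μ : Measure Ω) (lam nu : ℝ)
    (X Y : ℕ → Ω → ℝ) : Prop where
  rate_pos : 0 < lam
  rate_nonneg : 0 ≤ nu
  measurable_arrival : ∀ n, Measurable (X n)
  measurable_catastrophe : ∀ n, Measurable (Y n)
  law_arrival : ∀ n, μ.map (X n) = expMeasure lam
  law_catastrophe : 0 < nu → ∀ n, μ.map (Y n) = expMeasure nu
  indep : iIndepFun (Sum.elim X Y : ℕ ⊕ ℕ → Ω → ℝ) μ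

/-- The catastrophe epochs; a Poisson process of rate `0` has no points. -/
def catastropheTimes {Ω : Type*} (nu : ℝ) (Y : ℕ → Ω → ℝ) (w : Ω) : Set ℝ :=
  {c | 0 < nu ∧ ∃ k, c = epoch Y k w}

/-- The number of customers present at time `t`, each of them having service time `b`.
Customer `n` is present if he has arrived, his service is not completed, and there has been no
catastrophe since his arrival. -/
noncomputable def numInSystem {Ω : Type*} (nu b : ℝ) (X Y : ℕ → Ω → ℝ) (t : ℝ) (w : Ω) : ℕ∞ :=
  {n : ℕ | epoch X n w ≤ t ∧ t < epoch X n w + b ∧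
    ∀ c ∈ catastropheTimes nu Y w, ¬ (epoch X n w < c ∧ c ≤ t)}.encard

/-- `P₀(t)`: the probability that the system is empty at time `t`. -/
noncomputable def idleProb {Ω : Type*} [MeasurableSpace Ω] (μ : Measure Ω) (nu b : ℝ)
    (X Y : ℕ → Ω → ℝ) (t : ℝ) : ℝ :=
  μ.real {w | numInSystem nu b X Y t w = 0}

/-- The Laplace transform of `P₀`. -/
noncomputable def idleTransform {Ω : Type*} [MeasurableSpace Ω] (μ : Measure Ω) (nu b : ℝ)
    (X Y : ℕ → Ω → ℝ) (s : ℂ) : ℂ :=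
  ∫ t in Set.Ioi (0 : ℝ), Complex.exp (-s * t) * (idleProb μ nu b X Y t : ℂ)

/-- The times from the first arrival on at which the system is empty. -/
def emptyTimes {Ω : Type*} (nu b : ℝ) (X Y : ℕ → Ω → ℝ) (w : Ω) : Set ℝ :=
  {t | epoch X 0 w ≤ t ∧ numInSystem nu b X Y t w = 0}

/-- The length of the (first) busy period: it begins at the first arrival and ends when the system
is free of customers. -/
noncomputable def busyPeriod {Ω : Type*} (nu b : ℝ) (X Y : ℕ → Ω → ℝ) (w : Ω) : ℝ :=
  sInf (emptyTimes nu b X Y w) - epoch X 0 w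

/-- The length of the (first) busy cycle: the idle period (the time until the first arrival) plus
the busy period. -/
noncomputable def busyCycle {Ω : Type*} (nu b : ℝ) (X Y : ℕ → Ω → ℝ) (w : Ω) : ℝ :=
  epoch X 0 w + busyPeriod nu b X Y w

/-- The Laplace–Stieltjes transform of the distribution of `Z`. -/
noncomputable def lst {Ω : Type*} [MeasurableSpace Ω] (μ : Measure Ω) (Z : Ω → ℝ) (s : ℂ) : ℂ :=
  ∫ w, Complex.exp (-s * Z w) ∂μ

end MDInf

namespace MDInf

/-! Idle probability. All services last equally long and a catastrophe removes everyone, so the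
system is non-empty at `t` exactly when the latest arrival up to `t` is still present. If that
arrival occurred at `u`, then `t - b < u`, no arrival follows in `(u, t]` (probability `e^{-lam
(t-u)}`) and no catastrophe occurs there (probability `e^{-nu (t-u)}`). Summed over the index of the
customer, the laws of the arrival epochs have density `lam` (`IsExpGaps.tsum_lintegral_epoch`), so
`1 - P₀(t)` is `lam` times the integral of `e^{-(lam+nu)(t-u)}` over `max(t-b,0) < u ≤ t`
(`IsPoissonInput.idleProb_eq`). An elementary integration gives the transform.

Busy period. Almost surely it is the minimum of `B`, its length if there were no catastrophes, and
the time `R` from the first arrival to the next catastrophe (`isLeast_emptyTimes`). `B` is a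
geometric number of gaps shorter than `b`, plus a final `b`, so its transform is a geometric series
(`IsExpGaps.integral_exp_undisturbed`). By memorylessness (`IsExpGaps.measure_no_epoch`), `R` is
exponential and independent of the arrivals, or infinite if `nu = 0`. Hence, with the arrivals
frozen, `(s + nu) E e^{-s min(B,R)} = nu + s e^{-(s+nu)B}`, and the transform of `B` at `s + nu`
finishes the computation. Carrying the factor `e^{-p X₀}` along gives the busy cycle as well
(`IsPoissonInput.integral_exp_busyTime`).

Moments. For real `σ > 0` the transform is `1 - σ g(σ)` with `g` differentiable at `0`, so the
moments are `g(0)` and `-2 g'(0)`; integrability comes from Fatou's lemma (`moments_of_transform`).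
-/

/-! ### Exponential gaps and the laws of the epochs. -/

/-- The gaps of a Poisson process of rate `r`: i.i.d. exponential random variables. -/
structure IsExpGaps {Ω : Type*} [MeasurableSpace Ω] (μ : Measure Ω) (r : ℝ)
    (G : ℕ → Ω → ℝ) : Prop where
  rate_pos : 0 < r
  measurable : ∀ n, Measurable (G n)
  law : ∀ n, μ.map (G n) = expMeasure r
  indep : iIndepFun G μ

theorem lintegral_expMeasure (r : ℝ) (f : ℝ → ENNReal) :
    ∫⁻ x, f x ∂(expMeasure r) =
      ∫⁻ x in Set.Ioi 0, ENNReal.ofReal (r * Real.exp (-(r * x))) * f x := by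
  have h : expMeasure r = volume.withDensity (exponentialPDF r) := rfl
  rw [h, lintegral_withDensity_eq_lintegral_mul_non_measurable]
  · rw [← lintegral_indicator measurableSet_Ioi]
    refine lintegral_congr_ae ?_
    have h0 : ∀ᵐ x : ℝ, x ≠ 0 := by simp [ae_iff]
    filter_upwards [h0] with x hx
    rcases lt_or_gt_of_ne hx with hx | hx
    · simp [exponentialPDF_of_neg hx, not_lt.2 hx.le]
    · simp [exponentialPDF_of_nonneg hx.le, hx]
  · exact (measurable_exponentialPDFReal r).ennreal_ofReal
  · simp [exponentialPDF]

/-- Freezing: independent variables may be integrated one after the other. -/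
theorem lintegral_indepFun {Ω α β : Type*} [MeasurableSpace Ω] [MeasurableSpace α]
    [MeasurableSpace β] {μ : Measure Ω} [IsProbabilityMeasure μ] {U : Ω → α} {V : Ω → β}
    (hU : Measurable U) (hV : Measurable V) (h : IndepFun U V μ) {F : α → β → ENNReal}
    (hF : Measurable (Function.uncurry F)) :
    ∫⁻ w, F (U w) (V w) ∂μ = ∫⁻ w, ∫⁻ v, F (U w) v ∂(μ.map V) ∂μ := by
  have h1 := (indepFun_iff_map_prod_eq_prod_map_map hU.aemeasurable hV.aemeasurable).1 h
  have : IsProbabilityMeasure (μ.map V) := Measure.isProbabilityMeasure_map hV.aemeasurable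
  have h2 : ∫⁻ w, F (U w) (V w) ∂μ =
      ∫⁻ p, Function.uncurry F p ∂(μ.map (fun w => (U w, V w))) := by
    rw [lintegral_map hF (hU.prodMk hV)]; rfl
  rw [h2, h1, lintegral_prod _ hF.aemeasurable]
  rw [lintegral_map hF.lintegral_prod_right' hU]
  rfl

theorem epoch_zero {Ω : Type*} (G : ℕ → Ω → ℝ) (w : Ω) : epoch G 0 w = G 0 w := by
  simp [epoch]

theorem epoch_succ {Ω : Type*} (G : ℕ → Ω → ℝ) (n : ℕ) (w : Ω) :
    epoch G (n + 1) w = epoch G n w + G (n + 1) w := by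
  simp [epoch, Finset.sum_range_succ]

theorem measurable_epoch {Ω : Type*} [MeasurableSpace Ω] {G : ℕ → Ω → ℝ}
    (hG : ∀ n, Measurable (G n)) (n : ℕ) : Measurable (epoch G n) := by
  unfold epoch
  exact Finset.measurable_fun_sum _ fun i _ => hG i

theorem lintegral_pow_Ioo (n : ℕ) {z : ℝ} (hz : 0 ≤ z) :
    ∫⁻ x in Set.Ioo 0 z, ENNReal.ofReal (x ^ n / n.factorial) =
      ENNReal.ofReal (z ^ (n + 1) / (n + 1).factorial) := by
  rw [← ofReal_integral_eq_lintegral_ofReal]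
  · rw [← integral_Ioc_eq_integral_Ioo, ← intervalIntegral.integral_of_le hz,
      intervalIntegral.integral_div, integral_pow]
    congr 1
    rw [Nat.factorial_succ]
    push_cast
    field_simp
    simp
  · have : Continuous fun x : ℝ => x ^ n / n.factorial := by fun_prop
    exact (this.integrableOn_Icc (a := 0) (b := z)).mono_set Set.Ioo_subset_Icc_self
  · filter_upwards [ae_restrict_mem measurableSet_Ioo] with x hx
    have := hx.1.le
    simp only [Pi.zero_apply]; positivity

theorem IsExpGaps.indepFun_epoch {Ω : Type*} [MeasurableSpace Ω] {μ : Measure Ω} {r : ℝ}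
    {G : ℕ → Ω → ℝ} (h : IsExpGaps μ r G) (n : ℕ) : IndepFun (epoch G n) (G (n + 1)) μ := by
  have := h.indep.indepFun_finsetSum_of_notMem h.measurable (s := Finset.range (n + 1))
    (i := n + 1) (by simp)
  convert this using 1
  ext w; simp [epoch]

/-- Induction step for the Erlang density. With `z = x + y` the two exponentials merge into
`e^{-rz}`, so after swapping the integrals only the integral of `x^n / n!` over `(0, z)` remains. -/
theorem lintegral_convolve_exp (n : ℕ) {r : ℝ} (hr : 0 < r) {f : ℝ → ENNReal}
    (hf : Measurable f) :
    ∫⁻ x in Set.Ioi 0, ENNReal.ofReal (r ^ (n + 1) * x ^ n / n.factorial * Real.exp (-(r * x))) *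
        ∫⁻ y in Set.Ioi 0, ENNReal.ofReal (r * Real.exp (-(r * y))) * f (x + y) =
      ∫⁻ x in Set.Ioi 0, ENNReal.ofReal
        (r ^ (n + 1 + 1) * x ^ (n + 1) / (n + 1).factorial * Real.exp (-(r * x))) * f x := by
  have h1 : ∀ x : ℝ, ∫⁻ y in Set.Ioi 0, ENNReal.ofReal (r * Real.exp (-(r * y))) * f (x + y) =
      ∫⁻ z, (Set.Ioi x).indicator
        (fun z => ENNReal.ofReal (r * Real.exp (-(r * (z - x)))) * f z) z := by
    intro x
    rw [← lintegral_indicator measurableSet_Ioi, ← lintegral_add_left_eq_self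
      ((Set.Ioi x).indicator _) x]
    congr 1; ext y
    simp [Set.indicator_apply]
  simp_rw [h1]
  rw [← lintegral_indicator measurableSet_Ioi, ← lintegral_indicator measurableSet_Ioi]
  have h2 : ∀ x : ℝ, (Set.Ioi (0:ℝ)).indicator (fun x => ENNReal.ofReal
        (r ^ (n + 1) * x ^ n / n.factorial * Real.exp (-(r * x))) *
        ∫⁻ z, (Set.Ioi x).indicator
        (fun z => ENNReal.ofReal (r * Real.exp (-(r * (z - x)))) * f z) z) x =
      ∫⁻ z, (Set.Ioo 0 z).indicator (fun x => ENNReal.ofReal (x ^ n / n.factorial)) x *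
        (ENNReal.ofReal (r ^ (n + 2) * Real.exp (-(r * z))) * f z) := by
    intro x
    by_cases hx : 0 < x
    · rw [Set.indicator_of_mem (by exact hx), ← lintegral_const_mul']
      · congr 1; ext z
        by_cases hz : x < z
        · rw [Set.indicator_of_mem (by exact hz), Set.indicator_of_mem (by exact ⟨hx, hz⟩),
            ← mul_assoc, ← mul_assoc, ← ENNReal.ofReal_mul (by positivity),
            ← ENNReal.ofReal_mul (by positivity)]
          congr 2
          have : Real.exp (-(r * z)) = Real.exp (-(r * x)) * Real.exp (-(r * (z - x))) := by
            rw [← Real.exp_add]; ring_nf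
          rw [this]; ring
        · rw [Set.indicator_of_notMem (by exact hz), Set.indicator_of_notMem (fun h => hz h.2)]
          simp
      · exact ENNReal.ofReal_ne_top
    · rw [Set.indicator_of_notMem (by exact hx)]
      have (z : ℝ) : x ∉ Set.Ioo 0 z := fun h => hx h.1
      simp [this]
  simp_rw [h2]
  rw [lintegral_lintegral_swap]
  · congr 1; ext z
    rw [lintegral_mul_const, lintegral_indicator measurableSet_Ioo]
    · by_cases hz : 0 < z
      · rw [Set.indicator_of_mem (by exact hz), lintegral_pow_Ioo n hz.le, ← mul_assoc,
          ← ENNReal.ofReal_mul (by positivity)]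
        congr 2; ring
      · rw [Set.indicator_of_notMem (by exact hz), Set.Ioo_eq_empty (by simpa using hz)]
        simp
    · exact Measurable.indicator (by fun_prop) measurableSet_Ioo
  · refine Measurable.aemeasurable ?_
    refine Measurable.mul ?_ ?_
    · have : (fun p : ℝ × ℝ => (Set.Ioo 0 p.2).indicator
          (fun x => ENNReal.ofReal (x ^ n / n.factorial)) p.1) =
          {p : ℝ × ℝ | 0 < p.1 ∧ p.1 < p.2}.indicator
            (fun p => ENNReal.ofReal (p.1 ^ n / n.factorial)) := by
        ext p; simp [Set.indicator_apply]
      have hm : Measurable (fun p : ℝ × ℝ => (Set.Ioo 0 p.2).indicator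
          (fun x => ENNReal.ofReal (x ^ n / n.factorial)) p.1) := by
        rw [this]
        refine Measurable.indicator (by fun_prop) ?_
        exact (measurableSet_lt measurable_const measurable_fst).inter
          (measurableSet_lt measurable_fst measurable_snd)
      exact hm
    · fun_prop

/-- The `n`-th epoch of a Poisson process has an Erlang distribution. -/
theorem IsExpGaps.lintegral_epoch {Ω : Type*} [MeasurableSpace Ω] {μ : Measure Ω}
    [IsProbabilityMeasure μ] {r : ℝ} {G : ℕ → Ω → ℝ} (h : IsExpGaps μ r G) (n : ℕ)
    {f : ℝ → ENNReal} (hf : Measurable f) :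
    ∫⁻ w, f (epoch G n w) ∂μ = ∫⁻ x in Set.Ioi 0,
      ENNReal.ofReal (r ^ (n + 1) * x ^ n / n.factorial * Real.exp (-(r * x))) * f x := by
  induction n generalizing f with
  | zero =>
    simp_rw [epoch_zero]
    rw [← lintegral_map hf (h.measurable 0), h.law, lintegral_expMeasure]
    simp
  | succ n ih =>
    simp_rw [epoch_succ]
    rw [lintegral_indepFun (F := fun u v => f (u + v)) (measurable_epoch h.measurable n)
      (h.measurable _) (h.indepFun_epoch n) (by simp only [Function.uncurry_def]; fun_prop)]
    simp_rw [h.law, lintegral_expMeasure]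
    rw [ih (f := fun x => ∫⁻ y in Set.Ioi 0, ENNReal.ofReal (r * Real.exp (-(r * y))) * f (x + y)),
      lintegral_convolve_exp n h.rate_pos hf]
    exact Measurable.lintegral_prod_right' (f := fun p : ℝ × ℝ =>
      ENNReal.ofReal (r * Real.exp (-(r * p.2))) * f (p.1 + p.2)) (by fun_prop)

/-- The expected number of epochs of a Poisson process in `dx` is `r dx`. -/
theorem IsExpGaps.tsum_lintegral_epoch {Ω : Type*} [MeasurableSpace Ω] {μ : Measure Ω}
    [IsProbabilityMeasure μ] {r : ℝ} {G : ℕ → Ω → ℝ} (h : IsExpGaps μ r G)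
    {f : ℝ → ENNReal} (hf : Measurable f) :
    ∑' n, ∫⁻ w, f (epoch G n w) ∂μ = ENNReal.ofReal r * ∫⁻ x in Set.Ioi 0, f x := by
  simp_rw [h.lintegral_epoch _ hf]
  rw [← lintegral_tsum (fun n => by fun_prop), ← lintegral_const_mul _ hf]
  refine setLIntegral_congr_fun measurableSet_Ioi fun x hx => ?_
  have hx : 0 < x := hx
  have hr := h.rate_pos
  rw [ENNReal.tsum_mul_right]
  congr 1
  -- The Erlang densities add up to `r e^{-rx}` times the exponential series of `rx`, which is `r`.
  have hs : HasSum (fun n : ℕ => r ^ (n + 1) * x ^ n / n.factorial * Real.exp (-(r * x))) r := by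
    have h1 := NormedSpace.expSeries_div_hasSum_exp (r * x)
    rw [← Real.exp_eq_exp_ℝ] at h1
    have h2 := (h1.mul_left r).mul_right (Real.exp (-(r * x)))
    rw [mul_assoc, ← Real.exp_add, add_neg_cancel, Real.exp_zero, mul_one] at h2
    have h3 : (fun n : ℕ => r ^ (n + 1) * x ^ n / n.factorial * Real.exp (-(r * x))) =
        fun n : ℕ => r * ((r * x) ^ n / n.factorial) * Real.exp (-(r * x)) := by
      ext n; rw [mul_pow]; ring
    rw [h3]; exact h2
  rw [← ENNReal.ofReal_tsum_of_nonneg (fun n => by positivity) hs.summable, hs.tsum_eq]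

theorem IsExpGaps.ae_gap_pos {Ω : Type*} [MeasurableSpace Ω] {μ : Measure Ω}
    {r : ℝ} {G : ℕ → Ω → ℝ} (h : IsExpGaps μ r G) : ∀ᵐ w ∂μ, ∀ n, 0 < G n w := by
  rw [ae_all_iff]
  intro n
  have h1 : ∀ᵐ x ∂(μ.map (G n)), 0 < x := by
    rw [h.law, ae_iff, ← lintegral_indicator_one (by measurability), lintegral_expMeasure]
    rw [setLIntegral_congr_fun (g := fun _ => 0) measurableSet_Ioi]
    · simp
    · intro x hx
      simp [Set.mem_Ioi.1 hx]
  exact ae_of_ae_map (h.measurable n).aemeasurable h1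

/-- Borel–Cantelli: the probabilities that the `n`-th epoch is at most `m` sum to `r m`, which is
finite, so almost surely only finitely many epochs lie below each `m`. -/
theorem IsExpGaps.ae_tendsto_epoch {Ω : Type*} [MeasurableSpace Ω] {μ : Measure Ω}
    [IsProbabilityMeasure μ] {r : ℝ} {G : ℕ → Ω → ℝ} (h : IsExpGaps μ r G) :
    ∀ᵐ w ∂μ, Tendsto (fun n => epoch G n w) atTop atTop := by
  have h1 : ∀ᵐ w ∂μ, ∀ m : ℕ, ∀ᶠ n in atTop, w ∉ {w | epoch G n w ≤ (m : ℝ)} := by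
    rw [ae_all_iff]
    intro m
    apply ae_eventually_notMem
    have h2 := h.tsum_lintegral_epoch (f := (Set.Iic (m : ℝ)).indicator 1)
      (measurable_one.indicator measurableSet_Iic)
    have h3 : ∀ n, ∫⁻ w, (Set.Iic (m : ℝ)).indicator 1 (epoch G n w) ∂μ =
        μ {w | epoch G n w ≤ (m : ℝ)} := fun n => by
      rw [← lintegral_indicator_one (measurableSet_le (measurable_epoch h.measurable n)
        measurable_const)]
      rfl
    simp_rw [h3] at h2
    rw [h2, lintegral_indicator_one measurableSet_Iic, Measure.restrict_apply measurableSet_Iic,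
      Set.Iic_inter_Ioi]
    simp [ENNReal.mul_eq_top]
  filter_upwards [h1] with w hw
  rw [tendsto_atTop]
  intro x
  obtain ⟨m, hm⟩ := exists_nat_ge x
  refine (hw m).mono fun n hn => ?_
  exact hm.trans (not_le.1 hn).le

/-! ### The last epoch before a given time, and memorylessness. -/

theorem expMeasure_Ioi {r c : ℝ} (hr : 0 < r) (hc : 0 ≤ c) :
    expMeasure r (Set.Ioi c) = ENNReal.ofReal (Real.exp (-(r * c))) := by
  have := isProbabilityMeasure_expMeasure hr
  have h1 := cdf_expMeasure_eq hr c
  rw [cdf_eq_real, if_pos hc] at h1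
  rw [← Set.compl_Iic, ← ofReal_measureReal, probReal_compl_eq_one_sub measurableSet_Iic, h1]
  congr 1; ring

theorem strictMono_epoch {Ω : Type*} {G : ℕ → Ω → ℝ} {w : Ω} (h : ∀ n, 0 < G n w) :
    StrictMono fun n => epoch G n w :=
  strictMono_nat_of_lt_succ fun n => by rw [epoch_succ]; linarith [h (n + 1)]

/-- A sequence tending to infinity that starts below `a` has a last term below `a`
before it first exceeds `a`. -/
theorem exists_le_lt_succ {u : ℕ → ℝ} (hu : Tendsto u atTop atTop) {a : ℝ} (h0 : u 0 ≤ a) :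
    ∃ n, u n ≤ a ∧ a < u (n + 1) := by
  classical
  have hex : ∃ n, a < u n := ((tendsto_atTop.1 hu (a + 1)).exists).imp fun n hn => by linarith
  have h1 := Nat.find_spec hex
  rcases hk : Nat.find hex with _ | n
  · rw [hk] at h1; linarith
  · refine ⟨n, not_lt.1 (Nat.find_min hex (m := n) (by omega)), ?_⟩
    rwa [hk] at h1

theorem eq_of_le_lt_succ {u : ℕ → ℝ} (hu : StrictMono u) {a : ℝ} {m n : ℕ}
    (hm : u m ≤ a ∧ a < u (m + 1)) (hn : u n ≤ a ∧ a < u (n + 1)) : m = n := by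
  have h1 := hu.lt_iff_lt.1 (hm.1.trans_lt hn.2)
  have h2 := hu.lt_iff_lt.1 (hn.1.trans_lt hm.2)
  omega

/-- Decomposition with respect to the last epoch up to time `a`. -/
theorem IsExpGaps.lintegral_eq_tsum_last {Ω : Type*} [MeasurableSpace Ω] {μ : Measure Ω}
    [IsProbabilityMeasure μ] {r : ℝ} {G : ℕ → Ω → ℝ} (h : IsExpGaps μ r G) (a : ℝ)
    {f : Ω → ENNReal} (hf : Measurable f) :
    ∫⁻ w, f w ∂μ = ∫⁻ w, {w | a < epoch G 0 w}.indicator f w ∂μ +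
      ∑' n, ∫⁻ w, {w | epoch G n w ≤ a ∧ a < epoch G (n + 1) w}.indicator f w ∂μ := by
  have hm := measurable_epoch h.measurable
  have hs : ∀ n, MeasurableSet {w | epoch G n w ≤ a ∧ a < epoch G (n + 1) w} := fun n =>
    (measurableSet_le (hm n) measurable_const).inter
      (measurableSet_lt measurable_const (hm (n + 1)))
  rw [← lintegral_tsum fun n => (hf.indicator (hs n)).aemeasurable, ← lintegral_add_left
    (hf.indicator (measurableSet_lt measurable_const (hm 0)))]
  refine lintegral_congr_ae ?_
  filter_upwards [h.ae_gap_pos, h.ae_tendsto_epoch] with w hpos hlim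
  have hmono := strictMono_epoch hpos
  by_cases h0 : a < epoch G 0 w
  · have h1 : ∀ n, w ∉ {w | epoch G n w ≤ a ∧ a < epoch G (n + 1) w} := fun n hn =>
      absurd (h0.trans_le (hmono.monotone (Nat.zero_le n))) (not_lt.2 hn.1)
    rw [Set.indicator_of_mem (by exact h0)]
    simp [Set.indicator_of_notMem (h1 _)]
  · obtain ⟨n, hn⟩ := exists_le_lt_succ hlim (not_lt.1 h0)
    rw [Set.indicator_of_notMem (by exact h0), tsum_eq_single n, Set.indicator_of_mem (by exact hn),
      zero_add]
    intro m hmn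
    rw [Set.indicator_of_notMem]
    exact fun hm' => hmn (eq_of_le_lt_succ hmono hm' hn)

theorem lintegral_exp_Ioc {κ c p q : ℝ} (hκ : 0 < κ) (hpq : p ≤ q) :
    ∫⁻ u in Set.Ioc p q, ENNReal.ofReal (Real.exp (-(κ * (c - u)))) =
      ENNReal.ofReal ((Real.exp (-(κ * (c - q))) - Real.exp (-(κ * (c - p)))) / κ) := by
  have hc : Continuous fun u : ℝ => Real.exp (-(κ * (c - u))) := by fun_prop
  rw [← ofReal_integral_eq_lintegral_ofReal, ← intervalIntegral.integral_of_le hpq]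
  · rw [intervalIntegral.integral_eq_sub_of_hasDerivAt
      (f := fun u => Real.exp (-(κ * (c - u))) / κ)]
    · rw [sub_div]
    · intro u _
      have h1 : HasDerivAt (fun u : ℝ => -(κ * (c - u))) (-(κ * -1)) u :=
        (((hasDerivAt_id u).const_sub c).const_mul κ).fun_neg
      have h2 := h1.exp.div_const κ
      rwa [mul_neg_one, neg_neg, mul_div_cancel_right₀ _ hκ.ne'] at h2
    · exact hc.intervalIntegrable _ _
  · exact (hc.integrableOn_Icc (a := p) (b := q)).mono_set Set.Ioc_subset_Icc_self
  · exact Eventually.of_forall fun u => (Real.exp_pos _).le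

/-- Memorylessness: the probability that a Poisson process has no point in `(a, a + x]`. -/
theorem IsExpGaps.measure_no_epoch {Ω : Type*} [MeasurableSpace Ω] {μ : Measure Ω}
    [IsProbabilityMeasure μ] {r : ℝ} {G : ℕ → Ω → ℝ} (h : IsExpGaps μ r G) {a x : ℝ}
    (ha : 0 ≤ a) (hx : 0 ≤ x) :
    μ {w | ∀ n, ¬ (a < epoch G n w ∧ epoch G n w ≤ a + x)} =
      ENNReal.ofReal (Real.exp (-(r * x))) := by
  classical
  have hr := h.rate_pos
  have hm := measurable_epoch h.measurable
  have hS : MeasurableSet {w | ∀ n, ¬ (a < epoch G n w ∧ epoch G n w ≤ a + x)} := by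
    have : {w | ∀ n, ¬ (a < epoch G n w ∧ epoch G n w ≤ a + x)} =
        ⋂ n, {w | a < epoch G n w ∧ epoch G n w ≤ a + x}ᶜ := by ext; simp
    rw [this]
    exact MeasurableSet.iInter fun n => ((measurableSet_lt measurable_const (hm n)).inter
      (measurableSet_le (hm n) measurable_const)).compl
  rw [← lintegral_indicator_one hS, h.lintegral_eq_tsum_last a (measurable_one.indicator hS)]
  -- No epoch up to `a`: the first gap must then exceed `a + x`.
  have hfirst : ∫⁻ w, {w | a < epoch G 0 w}.indicator ({w | ∀ n, ¬ (a < epoch G n w ∧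
      epoch G n w ≤ a + x)}.indicator 1) w ∂μ = ENNReal.ofReal (Real.exp (-(r * (a + x)))) := by
    rw [← expMeasure_Ioi hr (by positivity), ← h.law 0, Measure.map_apply (h.measurable 0)
      measurableSet_Ioi, ← lintegral_indicator_one (h.measurable 0 measurableSet_Ioi)]
    refine lintegral_congr_ae ?_
    filter_upwards [h.ae_gap_pos] with w hpos
    have hmono := strictMono_epoch hpos
    have h0 := epoch_zero G w
    simp only [Set.indicator_apply, Set.mem_ofPred_eq, Set.mem_preimage, Set.mem_Ioi, ← h0]
    by_cases hc : a + x < epoch G 0 w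
    · rw [if_pos (by linarith), if_pos, if_pos hc]
      intro n hn
      have : epoch G 0 w ≤ epoch G n w := hmono.monotone (Nat.zero_le n)
      linarith [hn.2]
    · rw [if_neg hc]
      split_ifs with h1 h2
      · exact absurd ⟨h1, not_lt.1 hc⟩ (h2 0)
      · rfl
      · rfl
  -- If the last epoch up to `a` is at `u`, the next gap, which is independent of `u`, must exceed
  -- `a + x - u`.
  have hlast : ∀ n, ∫⁻ w, {w | epoch G n w ≤ a ∧ a < epoch G (n + 1) w}.indicator
      ({w | ∀ n, ¬ (a < epoch G n w ∧ epoch G n w ≤ a + x)}.indicator 1) w ∂μ =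
      ∫⁻ w, (Set.Iic a).indicator
        (fun u => ENNReal.ofReal (Real.exp (-(r * (a + x - u))))) (epoch G n w) ∂μ := by
    intro n
    have h1 : ∫⁻ w, {w | epoch G n w ≤ a ∧ a < epoch G (n + 1) w}.indicator
        ({w | ∀ n, ¬ (a < epoch G n w ∧ epoch G n w ≤ a + x)}.indicator 1) w ∂μ =
        ∫⁻ w, {p : ℝ × ℝ | p.1 ≤ a ∧ a + x - p.1 < p.2}.indicator 1
          (epoch G n w, G (n + 1) w) ∂μ := by
      refine lintegral_congr_ae ?_
      filter_upwards [h.ae_gap_pos] with w hpos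
      have hmono := strictMono_epoch hpos
      have hs := epoch_succ G n w
      simp only [Set.indicator_apply, Set.mem_ofPred_eq]
      by_cases hc : epoch G n w ≤ a
      · by_cases hd : a + x < epoch G (n + 1) w
        · rw [if_pos ⟨hc, by linarith⟩, if_pos, if_pos ⟨hc, by linarith⟩]
          · rfl
          intro k hk
          have h1 := hmono.lt_iff_lt.1 (hc.trans_lt hk.1)
          have h2 := hmono.lt_iff_lt.1 (hk.2.trans_lt hd)
          omega
        · rw [if_neg (c := _ ∧ a + x - epoch G n w < G (n + 1) w) (by rintro ⟨-, h2⟩; linarith)]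
          split_ifs with h1 h2
          · exact absurd ⟨h1.2, not_lt.1 hd⟩ (h2 (n + 1))
          · rfl
          · rfl
      · rw [if_neg (fun h => hc h.1), if_neg (fun h => hc h.1)]
    have hT : MeasurableSet {p : ℝ × ℝ | p.1 ≤ a ∧ a + x - p.1 < p.2} :=
      (measurableSet_le measurable_fst measurable_const).inter
        (measurableSet_lt (measurable_const.sub measurable_fst) measurable_snd)
    rw [h1, lintegral_indepFun (F := fun u v => {p : ℝ × ℝ | p.1 ≤ a ∧ a + x - p.1 < p.2}.indicator
      1 (u, v)) (hm n) (h.measurable _) (h.indepFun_epoch n) (measurable_one.indicator hT)]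
    rw [h.law]
    congr 1; ext w
    by_cases hc : epoch G n w ≤ a
    · rw [Set.indicator_of_mem (by exact hc), ← expMeasure_Ioi hr (by linarith),
        ← lintegral_indicator_one measurableSet_Ioi]
      congr 1; ext v
      simp [Set.indicator_apply, hc]
    · rw [Set.indicator_of_notMem (by exact hc)]
      simp [hc]
  simp_rw [hlast]
  -- With epoch density `r`, the last-epoch terms add up to `e^{-rx} - e^{-r(a+x)}`; the first term
  -- supplies the missing `e^{-r(a+x)}`.
  rw [hfirst, h.tsum_lintegral_epoch (Measurable.indicator (by fun_prop) measurableSet_Iic),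
    lintegral_indicator measurableSet_Iic, Measure.restrict_restrict measurableSet_Iic,
    Set.Iic_inter_Ioi, lintegral_exp_Ioc hr ha, ← ENNReal.ofReal_mul hr.le, ← ENNReal.ofReal_add]
  · congr 1
    field_simp
    ring_nf
  · positivity
  · rw [mul_div_cancel₀ _ hr.ne', sub_nonneg, Real.exp_le_exp]
    nlinarith

/-! ### The two independent input processes. -/

theorem IsPoissonInput.arrivals {Ω : Type*} [MeasurableSpace Ω] {μ : Measure Ω} {lam nu : ℝ}
    {X Y : ℕ → Ω → ℝ} (h : IsPoissonInput μ lam nu X Y) : IsExpGaps μ lam X :=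
  ⟨h.rate_pos, h.measurable_arrival, h.law_arrival,
    h.indep.precomp (g := Sum.inl) Sum.inl_injective⟩

theorem IsPoissonInput.catastrophes {Ω : Type*} [MeasurableSpace Ω] {μ : Measure Ω} {lam nu : ℝ}
    {X Y : ℕ → Ω → ℝ} (h : IsPoissonInput μ lam nu X Y) (hnu : 0 < nu) : IsExpGaps μ nu Y :=
  ⟨hnu, h.measurable_catastrophe, h.law_catastrophe hnu,
    h.indep.precomp (g := Sum.inr) Sum.inr_injective⟩

/-- Disjoint index sets of an independent family generate independent σ-algebras, and a whole
sequence generates the supremum of the σ-algebras of its terms. -/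
theorem IsPoissonInput.indepFun {Ω : Type*} [MeasurableSpace Ω] {μ : Measure Ω} {lam nu : ℝ}
    {X Y : ℕ → Ω → ℝ} (h : IsPoissonInput μ lam nu X Y) :
    IndepFun (fun w i => X i w) (fun w i => Y i w) μ := by
  have hle : ∀ i, MeasurableSpace.comap (Sum.elim X Y i) inferInstance ≤ ‹MeasurableSpace Ω› := by
    rintro (i | i)
    · exact (h.measurable_arrival i).comap_le
    · exact (h.measurable_catastrophe i).comap_le
  have h1 := indep_iSup_of_disjoint hle h.indep.iIndep
    (S := Set.range Sum.inl) (T := Set.range Sum.inr) Set.isCompl_range_inl_range_inr.disjoint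
  rw [iSup_range, iSup_range] at h1
  rw [IndepFun_iff_Indep]
  convert h1 using 1
  · simp only [MeasurableSpace.pi, MeasurableSpace.comap_iSup, MeasurableSpace.comap_comp]; rfl
  · simp only [MeasurableSpace.pi, MeasurableSpace.comap_iSup, MeasurableSpace.comap_comp]; rfl

/-- Freezing for bounded complex functions. -/
theorem integral_indepFun {Ω α β : Type*} [MeasurableSpace Ω] [MeasurableSpace α]
    [MeasurableSpace β] {μ : Measure Ω} [IsProbabilityMeasure μ] {U : Ω → α} {V : Ω → β}
    (hU : Measurable U) (hV : Measurable V) (h : IndepFun U V μ) {F : α → β → ℂ}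
    (hF : Measurable (Function.uncurry F))
    (hi : Integrable (fun w => F (U w) (V w)) μ) :
    ∫ w, F (U w) (V w) ∂μ = ∫ w, ∫ w', F (U w) (V w') ∂μ ∂μ := by
  have h1 := (indepFun_iff_map_prod_eq_prod_map_map hU.aemeasurable hV.aemeasurable).1 h
  have : IsProbabilityMeasure (μ.map V) := Measure.isProbabilityMeasure_map hV.aemeasurable
  have : IsProbabilityMeasure (μ.map U) := Measure.isProbabilityMeasure_map hU.aemeasurable
  have h2 : ∫ w, F (U w) (V w) ∂μ =
      ∫ p, Function.uncurry F p ∂(μ.map (fun w => (U w, V w))) := by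
    rw [integral_map (hU.prodMk hV).aemeasurable hF.aestronglyMeasurable]; rfl
  have h3 : Integrable (Function.uncurry F) ((μ.map U).prod (μ.map V)) := by
    rw [← h1, integrable_map_measure hF.aestronglyMeasurable (hU.prodMk hV).aemeasurable]
    exact hi
  rw [h2, h1, integral_prod _ h3, integral_map hU.aemeasurable]
  · congr 1; ext w
    rw [integral_map hV.aemeasurable]
    · rfl
    · exact (hF.comp (measurable_const.prodMk measurable_id)).aestronglyMeasurable
  · exact hF.stronglyMeasurable.integral_prod_right'.aestronglyMeasurable

/-! ### Exponential transforms and the time to the next catastrophe. -/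

instance nullSingletonClass_expMeasure (r : ℝ) : NullSingletonClass (expMeasure r) :=
  ⟨fun x => (withDensity_absolutelyContinuous (μ := volume) (exponentialPDF r))
    (measure_singleton x)⟩

theorem measureReal_expMeasure_Ici {r c : ℝ} (hr : 0 < r) (hc : 0 ≤ c) :
    (expMeasure r).real (Set.Ici c) = Real.exp (-(r * c)) := by
  rw [measureReal_def, ← measure_congr Ioi_ae_eq_Ici, expMeasure_Ioi hr hc,
    ENNReal.toReal_ofReal (Real.exp_pos _).le]

theorem setIntegral_expMeasure (r : ℝ) (hr : 0 < r) (f : ℝ → ℂ) {s : Set ℝ}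
    (hs : MeasurableSet s) :
    ∫ x in s, f x ∂(expMeasure r) =
      ∫ x in s ∩ Set.Ioi 0, (r * Real.exp (-(r * x)) : ℝ) * f x := by
  have h : expMeasure r = volume.withDensity (exponentialPDF r) := rfl
  have hm : Measurable (exponentialPDF r) := (measurable_exponentialPDFReal r).ennreal_ofReal
  rw [h, setIntegral_withDensity_eq_setIntegral_toReal_smul hm (by simp [exponentialPDF]) _ hs,
    ← integral_indicator hs, ← integral_indicator (hs.inter measurableSet_Ioi)]
  refine integral_congr_ae ?_
  have h0 : ∀ᵐ x : ℝ, x ≠ 0 := by simp [ae_iff]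
  filter_upwards [h0] with x hx
  by_cases hxs : x ∈ s
  · rw [Set.indicator_of_mem hxs]
    rcases lt_or_gt_of_ne hx with hx | hx
    · rw [Set.indicator_of_notMem (fun h => absurd hx (not_lt.2 (le_of_lt h.2))),
        exponentialPDF_of_neg hx]
      simp
    · rw [Set.indicator_of_mem (show x ∈ s ∩ Set.Ioi 0 from ⟨hxs, hx⟩), exponentialPDF_of_nonneg hx.le,
        ENNReal.toReal_ofReal (by positivity)]
      simp
  · rw [Set.indicator_of_notMem hxs, Set.indicator_of_notMem (fun h => hxs h.1)]

/-- The transform of an exponential variable on the event that it is less than `c`. -/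
theorem setIntegral_exp_Iio {r c : ℝ} (hr : 0 < r) (hc : 0 ≤ c) {z : ℂ} (hz : z + r ≠ 0) :
    ∫ x in Set.Iio c, Complex.exp (-z * x) ∂(expMeasure r) =
      r * (1 - Complex.exp (-(z + r) * c)) / (z + r) := by
  rw [setIntegral_expMeasure r hr _ measurableSet_Iio, Set.Iio_inter_Ioi,
    ← integral_Ioc_eq_integral_Ioo, ← intervalIntegral.integral_of_le hc]
  have h1 : ∀ x : ℝ, ((r * Real.exp (-(r * x)) : ℝ) : ℂ) * Complex.exp (-z * x) =
      r * Complex.exp (-(z + r) * x) := fun x => by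
    push_cast
    rw [mul_assoc, ← Complex.exp_add]; ring_nf
  simp_rw [h1]
  rw [intervalIntegral.integral_const_mul, integral_exp_mul_complex (neg_ne_zero.2 hz)]
  rw [Complex.ofReal_zero, mul_zero, Complex.exp_zero]
  field_simp
  ring

/-- The time from `a` to the first catastrophe after `a`; it is `⊤` if there is none. -/
noncomputable def residual {Ω : Type*} (nu : ℝ) (Y : ℕ → Ω → ℝ) (a : ℝ) (w : Ω) : ENNReal :=
  open Classical in
  ⨅ k, if 0 < nu ∧ a < epoch Y k w then ENNReal.ofReal (epoch Y k w - a) else ⊤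

/-- Joint measurability in the starting time and the path is needed because the starting time will
be the random first arrival. -/
theorem measurable_residual (nu : ℝ) :
    Measurable fun p : ℝ × (ℕ → ℝ) => residual nu (fun i y => y i) p.1 p.2 := by
  unfold residual
  refine Measurable.iInf fun k => ?_
  have h1 : Measurable fun p : ℝ × (ℕ → ℝ) => epoch (fun i y => y i) k p.2 :=
    (measurable_epoch (fun i => measurable_pi_apply i) k).comp measurable_snd
  refine Measurable.ite ?_ (h1.sub measurable_fst).ennreal_ofReal measurable_const
  exact (MeasurableSet.const _).inter (measurableSet_lt measurable_fst h1)

theorem residual_of_rate_zero {Ω : Type*} {nu : ℝ} (h : ¬ 0 < nu) (Y : ℕ → Ω → ℝ) (a : ℝ) (w : Ω) :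
    residual nu Y a w = ⊤ := by
  simp [residual, h]

/-- The residual time is attained at a first catastrophe after `a`. -/
theorem exists_residual_eq {Ω : Type*} {nu : ℝ} (hnu : 0 < nu) {Y : ℕ → Ω → ℝ} {w : Ω}
    (hpos : ∀ n, 0 < Y n w) (hlim : Tendsto (fun n => epoch Y n w) atTop atTop) (a : ℝ) :
    ∃ k, a < epoch Y k w ∧ residual nu Y a w = ENNReal.ofReal (epoch Y k w - a) ∧
      ∀ j, a < epoch Y j w → epoch Y k w ≤ epoch Y j w := by
  classical
  have hex : ∃ n, a < epoch Y n w :=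
    ((tendsto_atTop.1 hlim (a + 1)).exists).imp fun n hn => by linarith
  have hmin : ∀ j, a < epoch Y j w → epoch Y (Nat.find hex) w ≤ epoch Y j w := fun j hj =>
    (strictMono_epoch hpos).monotone (Nat.find_min' hex hj)
  refine ⟨Nat.find hex, Nat.find_spec hex, le_antisymm ?_ ?_, hmin⟩
  · refine (iInf_le _ (Nat.find hex)).trans ?_
    rw [if_pos ⟨hnu, Nat.find_spec hex⟩]
  · refine le_iInf fun j => ?_
    split_ifs with hj
    · exact ENNReal.ofReal_le_ofReal (by linarith [hmin j hj.2])
    · exact le_top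

/-- The probability of no catastrophe in `(a, a + x]`. -/
theorem IsPoissonInput.measure_no_catastrophe {Ω : Type*} [MeasurableSpace Ω] {μ : Measure Ω}
    [IsProbabilityMeasure μ] {lam nu : ℝ} {X Y : ℕ → Ω → ℝ} (h : IsPoissonInput μ lam nu X Y)
    {a x : ℝ} (ha : 0 ≤ a) (hx : 0 ≤ x) :
    μ {w | ∀ c ∈ catastropheTimes nu Y w, ¬ (a < c ∧ c ≤ a + x)} =
      ENNReal.ofReal (Real.exp (-(nu * x))) := by
  rcases h.rate_nonneg.eq_or_lt with h0 | h0
  · simp [catastropheTimes, ← h0]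
  · rw [← (h.catastrophes h0).measure_no_epoch ha hx]
    congr 1; ext w
    simp only [catastropheTimes, Set.mem_ofPred_eq, h0, true_and]
    constructor
    · exact fun H n => H _ ⟨n, rfl⟩
    · rintro H c ⟨n, rfl⟩; exact H n

/-- Memorylessness: the residual time is exponential. -/
theorem IsPoissonInput.map_residual {Ω : Type*} [MeasurableSpace Ω] {μ : Measure Ω}
    [IsProbabilityMeasure μ] {lam nu : ℝ} {X Y : ℕ → Ω → ℝ} (h : IsPoissonInput μ lam nu X Y)
    (hnu : 0 < nu) {a : ℝ} (ha : 0 ≤ a) :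
    μ.map (fun w => (residual nu Y a w).toReal) = expMeasure nu := by
  have := isProbabilityMeasure_expMeasure hnu
  have hY := h.catastrophes hnu
  have hmeas : Measurable fun w => (residual nu Y a w).toReal :=
    ((measurable_residual nu).comp (measurable_const.prodMk
      (measurable_pi_lambda _ h.measurable_catastrophe))).ennreal_toReal
  have : IsProbabilityMeasure (μ.map (fun w => (residual nu Y a w).toReal)) :=
    Measure.isProbabilityMeasure_map hmeas.aemeasurable
  have hpos : ∀ x, 0 ≤ x → μ.map (fun w => (residual nu Y a w).toReal) (Set.Ioi x) =
      expMeasure nu (Set.Ioi x) := by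
    intro x hx
    rw [expMeasure_Ioi hnu hx, ← hY.measure_no_epoch ha hx,
      Measure.map_apply hmeas measurableSet_Ioi]
    -- The residual time exceeds `x` exactly when no catastrophe falls in `(a, a + x]`; this needs a
    -- first epoch after `a`, which exists almost surely.
    refine measure_congr ?_
    filter_upwards [hY.ae_gap_pos, hY.ae_tendsto_epoch] with w hp hl
    obtain ⟨k, hk1, hk2, hk3⟩ := exists_residual_eq hnu hp hl a
    refine propext ?_
    change x < (residual nu Y a w).toReal ↔ ∀ n, ¬ (a < epoch Y n w ∧ epoch Y n w ≤ a + x)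
    rw [hk2, ENNReal.toReal_ofReal (by linarith)]
    constructor
    · intro h1 n hn
      linarith [hk3 n hn.1, hn.2]
    · intro h1
      by_contra h2
      exact h1 k ⟨hk1, by linarith⟩
  refine Measure.ext_of_Iic _ _ fun x => ?_
  rcases le_or_gt 0 x with hx | hx
  · rw [← Set.compl_Ioi, prob_compl_eq_one_sub measurableSet_Ioi,
      prob_compl_eq_one_sub measurableSet_Ioi, hpos x hx]
  · have h1 : expMeasure nu (Set.Iic x) = 0 := by
      have h2 := cdf_expMeasure_eq hnu x
      rw [if_neg (by linarith), cdf_eq_real] at h2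
      exact (measureReal_eq_zero_iff).1 h2
    rw [h1, Measure.map_apply hmeas measurableSet_Iic]
    have h3 : (fun w => (residual nu Y a w).toReal) ⁻¹' Set.Iic x = ∅ := by
      ext w
      simp only [Set.mem_preimage, Set.mem_Iic, Set.mem_empty_iff_false, iff_false, not_le]
      exact hx.trans_le ENNReal.toReal_nonneg
    rw [h3, measure_empty]

/-- The integral is split at `y = c`. The product form, without division by `s + r`, is the one that
persists at rate `0` with `s = 0` in `integral_exp_min_residual`. -/
theorem integral_exp_min {r c : ℝ} (hr : 0 < r) (hc : 0 ≤ c) {s : ℂ} (hs : 0 ≤ s.re) :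
    (s + r) * ∫ y, Complex.exp (-s * (min c y : ℝ)) ∂(expMeasure r) =
      r + s * Complex.exp (-(s + r) * c) := by
  have := isProbabilityMeasure_expMeasure hr
  have hsr : s + r ≠ 0 := fun h => by
    have := congrArg Complex.re h
    simp at this; linarith
  have hint : Integrable (fun y : ℝ => Complex.exp (-s * (min c y : ℝ))) (expMeasure r) := by
    refine Integrable.mono' (g := fun _ => 1) (integrable_const _)
      (by fun_prop) ?_
    have h1 : ∀ᵐ y ∂(expMeasure r), 0 ≤ y := by
      rw [ae_iff]
      have h2 := cdf_expMeasure_eq hr 0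
      simp [cdf_eq_real, measureReal_eq_zero_iff] at h2
      exact measure_mono_null (fun y hy => (not_le.1 hy).le) h2
    filter_upwards [h1] with y hy
    rw [Complex.norm_exp, Real.exp_le_one_iff]
    simp only [neg_mul, Complex.neg_re, Complex.re_mul_ofReal]
    have := mul_nonneg hs (le_min hc hy)
    linarith
  rw [← integral_add_compl measurableSet_Iio hint (s := Set.Iio c), Set.compl_Iio]
  have h1 : ∫ y in Set.Iio c, Complex.exp (-s * (min c y : ℝ)) ∂(expMeasure r) =
      ∫ y in Set.Iio c, Complex.exp (-s * y) ∂(expMeasure r) :=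
    setIntegral_congr_fun measurableSet_Iio fun y hy => by
      rw [min_eq_right (Set.mem_Iio.1 hy).le]
  have h2 : ∫ y in Set.Ici c, Complex.exp (-s * (min c y : ℝ)) ∂(expMeasure r) =
      ∫ y in Set.Ici c, Complex.exp (-s * c) ∂(expMeasure r) :=
    setIntegral_congr_fun measurableSet_Ici fun y hy => by
      rw [min_eq_left (Set.mem_Ici.1 hy)]
  rw [h1, h2, setIntegral_exp_Iio hr hc hsr, setIntegral_const, measureReal_expMeasure_Ici hr hc]
  have h3 : Complex.exp (-(s + r) * c) = Complex.exp (-(r * c)) * Complex.exp (-s * c) := by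
    rw [← Complex.exp_add]; ring_nf
  rw [h3, Complex.real_smul]
  push_cast
  field_simp
  ring

/-- The transform of the time to the first catastrophe after `a`, censored at `c`. -/
theorem IsPoissonInput.integral_exp_min_residual {Ω : Type*} [MeasurableSpace Ω] {μ : Measure Ω}
    [IsProbabilityMeasure μ] {lam nu : ℝ} {X Y : ℕ → Ω → ℝ} (h : IsPoissonInput μ lam nu X Y)
    {a c : ℝ} (ha : 0 ≤ a) (hc : 0 ≤ c) {s : ℂ} (hs : 0 ≤ s.re) :
    (s + nu) * ∫ w, Complex.exp (-s * (min (ENNReal.ofReal c) (residual nu Y a w)).toReal) ∂μ =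
      nu + s * Complex.exp (-(s + nu) * c) := by
  rcases h.rate_nonneg.eq_or_lt with h0 | h0
  -- Without catastrophes the residual time is `⊤`, so the minimum is `c`.
  · have h1 : ∀ w, (min (ENNReal.ofReal c) (residual nu Y a w)).toReal = c := fun w => by
      rw [residual_of_rate_zero (by linarith), min_top_right, ENNReal.toReal_ofReal hc]
    simp_rw [h1]
    simp [← h0]
  · rw [← integral_exp_min h0 hc hs, ← h.map_residual h0 ha, integral_map]
    · congr 1
      refine integral_congr_ae ?_
      have hY := h.catastrophes h0
      filter_upwards [hY.ae_gap_pos, hY.ae_tendsto_epoch] with w hp hl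
      obtain ⟨k, hk1, hk2, hk3⟩ := exists_residual_eq h0 hp hl a
      rw [hk2, ← ENNReal.ofReal_min, ENNReal.toReal_ofReal (le_min hc (by linarith)),
        ENNReal.toReal_ofReal (by linarith)]
    · exact ((measurable_residual nu).comp (measurable_const.prodMk
        (measurable_pi_lambda _ h.measurable_catastrophe))).ennreal_toReal.aemeasurable
    · fun_prop

/-! ### The busy period without catastrophes. -/

/-- The length of the first busy period in the absence of catastrophes: the last customer of the
busy period is the first one whose successor arrives after a time at least `b`. -/
noncomputable def undisturbed {Ω : Type*} (b : ℝ) (X : ℕ → Ω → ℝ) (w : Ω) : ENNReal :=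
  open Classical in
  ⨅ n, if b ≤ X (n + 1) w then ENNReal.ofReal (epoch X n w - epoch X 0 w + b) else ⊤

theorem measurable_undisturbed {Ω : Type*} [MeasurableSpace Ω] (b : ℝ) {X : ℕ → Ω → ℝ}
    (hX : ∀ n, Measurable (X n)) : Measurable (undisturbed b X) := by
  unfold undisturbed
  refine Measurable.iInf fun n => ?_
  have hm := measurable_epoch hX
  exact Measurable.ite (measurableSet_le measurable_const (hX _))
    (((hm n).sub (hm 0)).add_const b).ennreal_ofReal measurable_const

/-- The event that customer `n` is the last one of the undisturbed busy period. -/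
def lastCustomer {Ω : Type*} (b : ℝ) (X : ℕ → Ω → ℝ) (n : ℕ) : Set Ω :=
  {w | (∀ i < n, X (i + 1) w < b) ∧ b ≤ X (n + 1) w}

theorem measurableSet_lastCustomer {Ω : Type*} [MeasurableSpace Ω] (b : ℝ) {X : ℕ → Ω → ℝ}
    (hX : ∀ n, Measurable (X n)) (n : ℕ) : MeasurableSet (lastCustomer b X n) := by
  have : lastCustomer b X n = (⋂ i, ⋂ (_ : i < n), {w | X (i + 1) w < b}) ∩
      {w | b ≤ X (n + 1) w} := by ext; simp [lastCustomer]
  rw [this]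
  exact (MeasurableSet.iInter fun i => MeasurableSet.iInter fun _ =>
    measurableSet_lt (hX _) measurable_const).inter (measurableSet_le measurable_const (hX _))

theorem pairwise_disjoint_lastCustomer {Ω : Type*} (b : ℝ) (X : ℕ → Ω → ℝ) :
    Pairwise (Function.onFun Disjoint (lastCustomer b X)) := by
  intro m n hmn
  rw [Function.onFun, Set.disjoint_left]
  intro w h1 h2
  rcases lt_or_gt_of_ne hmn with h | h
  · exact absurd h1.2 (not_le.2 (h2.1 m h))
  · exact absurd h2.2 (not_le.2 (h1.1 n h))

theorem undisturbed_eq {Ω : Type*} {b : ℝ} {X : ℕ → Ω → ℝ} {w : Ω} (hpos : ∀ n, 0 < X n w)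
    {n : ℕ} (hn : w ∈ lastCustomer b X n) :
    undisturbed b X w = ENNReal.ofReal (epoch X n w - epoch X 0 w + b) := by
  refine le_antisymm ((iInf_le _ n).trans (by rw [if_pos hn.2])) (le_iInf fun j => ?_)
  split_ifs with hj
  · refine ENNReal.ofReal_le_ofReal ?_
    have : n ≤ j := not_lt.1 fun h => absurd hj (not_le.2 (hn.1 j h))
    have : epoch X n w ≤ epoch X j w := (strictMono_epoch hpos).monotone this
    linarith
  · exact le_top

theorem epoch_eq_add_sum {Ω : Type*} (X : ℕ → Ω → ℝ) (n : ℕ) (w : Ω) :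
    epoch X n w = epoch X 0 w + ∑ i ∈ Finset.range n, X (i + 1) w := by
  rw [epoch_zero, epoch, Finset.sum_range_succ', add_comm]

/-- A gap is shorter than `b` with some probability `p < 1`, so by independence the first `n` gaps
after the first arrival are all short with probability `p ^ n`, which tends to `0`. The first long
gap then marks the last customer. -/
theorem IsExpGaps.ae_exists_lastCustomer {Ω : Type*} [MeasurableSpace Ω] {μ : Measure Ω}
    [IsProbabilityMeasure μ] {r : ℝ} {X : ℕ → Ω → ℝ} (h : IsExpGaps μ r X) {b : ℝ} (hb : 0 ≤ b) :
    ∀ᵐ w ∂μ, ∃ n, w ∈ lastCustomer b X n := by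
  classical
  have := isProbabilityMeasure_expMeasure h.rate_pos
  have h1 : ∀ᵐ w ∂μ, ∃ n, b ≤ X (n + 1) w := by
    rw [ae_iff]
    set p := expMeasure r (Set.Iio b) with hp
    have hp1 : p < 1 := by
      refine lt_of_le_of_ne prob_le_one fun h1 => ?_
      have h2 : expMeasure r (Set.Ici b) = 0 := by
        rw [← Set.compl_Iio, prob_compl_eq_zero_iff measurableSet_Iio]; exact h1
      have h3 := measureReal_expMeasure_Ici h.rate_pos hb
      rw [measureReal_def, h2] at h3
      exact absurd h3 (Real.exp_pos _).ne
    have h2 : ∀ n : ℕ, μ {w | ¬ ∃ n, b ≤ X (n + 1) w} ≤ p ^ n := by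
      intro n
      have h3 := h.indep.measure_inter_preimage_eq_mul (Finset.image Nat.succ (Finset.range n))
        (sets := fun _ => Set.Iio b) (fun _ _ => measurableSet_Iio)
      have h4 : ∀ i, μ (X i ⁻¹' Set.Iio b) = p := fun i => by
        rw [hp, ← h.law i, Measure.map_apply (h.measurable i) measurableSet_Iio]
      simp_rw [h4] at h3
      rw [Finset.prod_const, Finset.card_image_of_injective _ Nat.succ_injective,
        Finset.card_range] at h3
      rw [← h3]
      refine measure_mono fun w hw => ?_
      simp only [Set.mem_iInter, Finset.mem_image]
      rintro _ ⟨i, -, rfl⟩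
      exact not_le.1 fun h5 => hw ⟨i, h5⟩
    exact le_antisymm (ge_of_tendsto' (ENNReal.tendsto_pow_atTop_nhds_zero_of_lt_one hp1) h2)
      zero_le
  filter_upwards [h1] with w hw
  exact ⟨Nat.find hw, fun i hi => not_le.1 (Nat.find_min hw hi), Nat.find_spec hw⟩

theorem IsExpGaps.integral_prod_range {Ω : Type*} [MeasurableSpace Ω] {μ : Measure Ω}
    [IsProbabilityMeasure μ] {r : ℝ} {X : ℕ → Ω → ℝ} (h : IsExpGaps μ r X) (m : ℕ)
    {φ : ℕ → ℝ → ℂ} (hφ : ∀ i, Measurable (φ i)) :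
    ∫ w, ∏ i ∈ Finset.range m, φ i (X i w) ∂μ =
      ∏ i ∈ Finset.range m, ∫ x, φ i x ∂(expMeasure r) := by
  have h1 : iIndepFun (fun i : Fin m => X i) μ := h.indep.precomp Fin.val_injective
  simp_rw [Finset.prod_range]
  rw [h1.integral_fun_prod_comp (f := fun i : Fin m => φ i)
    (fun i => (h.measurable i).aemeasurable)
    (fun i => (hφ i).aestronglyMeasurable)]
  refine Finset.prod_congr rfl fun i _ => ?_
  rw [← h.law i, integral_map (h.measurable i).aemeasurable (hφ i).aestronglyMeasurable]

theorem integral_exp_expMeasure {r : ℝ} (hr : 0 < r) {z : ℂ} (hz : 0 ≤ z.re) :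
    ∫ x, Complex.exp (-z * x) ∂(expMeasure r) = r / (r + z) := by
  have h0 : (r + z).re = r + z.re := by simp
  have hne : (r : ℂ) + z ≠ 0 := fun h => by rw [h] at h0; simp at h0; linarith
  have h1 := setIntegral_expMeasure r hr (fun x => Complex.exp (-z * x)) MeasurableSet.univ
  rw [Measure.restrict_univ, Set.univ_inter] at h1
  have h2 : ∀ x : ℝ, ((r * Real.exp (-(r * x)) : ℝ) : ℂ) * Complex.exp (-z * x) =
      r * Complex.exp (-(r + z) * x) := fun x => by
    push_cast
    rw [mul_assoc, ← Complex.exp_add]; ring_nf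
  simp_rw [h1, h2]
  rw [integral_const_mul, integral_exp_mul_complex_Ioi (by simp; linarith), Complex.ofReal_zero,
    mul_zero, Complex.exp_zero, neg_div_neg_eq, mul_one_div]

/-- The joint transform of the first arrival and the undisturbed busy period. -/
theorem IsExpGaps.integral_exp_undisturbed {Ω : Type*} [MeasurableSpace Ω] {μ : Measure Ω}
    [IsProbabilityMeasure μ] {r : ℝ} {X : ℕ → Ω → ℝ} (h : IsExpGaps μ r X) {b : ℝ} (hb : 0 ≤ b)
    {s z : ℂ} (hs : 0 ≤ s.re) (hz : 0 ≤ z.re) :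
    r + z * Complex.exp ((r + z) * b) ≠ 0 ∧
    ∫ w, Complex.exp (-s * X 0 w) * Complex.exp (-z * (undisturbed b X w).toReal) ∂μ =
      r / (r + s) * ((r + z) / (r + z * Complex.exp ((r + z) * b))) := by
  classical
  have hr := h.rate_pos
  have hzr : z + r ≠ 0 := fun h0 => by
    have := congrArg Complex.re h0
    simp at this; linarith
  have hsr : r + s ≠ 0 := fun h0 => by
    have := congrArg Complex.re h0
    simp at this; linarith
  set f : Ω → ℂ := fun w =>
    Complex.exp (-s * X 0 w) * Complex.exp (-z * (undisturbed b X w).toReal) with hf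
  have hmu := (measurable_undisturbed b h.measurable).ennreal_toReal
  have hm0 := h.measurable 0
  have hfm : Measurable f := by fun_prop
  have hfi : Integrable f μ := by
    refine Integrable.mono' (g := fun _ => 1) (integrable_const _) hfm.aestronglyMeasurable ?_
    filter_upwards [h.ae_gap_pos] with w hpos
    simp only [hf]
    rw [← Complex.exp_add, Complex.norm_exp, Real.exp_le_one_iff]
    have h1 := mul_nonneg hs (hpos 0).le
    have h2 := mul_nonneg hz (ENNReal.toReal_nonneg (a := undisturbed b X w))
    simp only [neg_mul, Complex.add_re, Complex.neg_re, Complex.re_mul_ofReal]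
    linarith
  -- `q` is the transform of a gap restricted to the event that it is shorter than `b`. A long gap
  -- contributes `d`, its probability `e^{-rb}` times the factor `e^{-zb}` of the last service.
  set q : ℂ := r * (1 - Complex.exp (-(z + r) * b)) / (z + r) with hq
  set d : ℂ := Complex.exp (-(z + r) * b) with hd
  have hsum := hasSum_integral_iUnion (f := f) (μ := μ)
    (measurableSet_lastCustomer b h.measurable) (pairwise_disjoint_lastCustomer b X)
    hfi.integrableOn
  have hU : (⋃ n, lastCustomer b X n) =ᵐ[μ] Set.univ := by
    filter_upwards [h.ae_exists_lastCustomer hb] with w hw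
    refine propext ?_
    change w ∈ (⋃ n, lastCustomer b X n) ↔ w ∈ Set.univ
    simpa using hw
  rw [setIntegral_congr_set hU, Measure.restrict_univ] at hsum
  have hterm : ∀ n, ∫ w in lastCustomer b X n, f w ∂μ = r / (r + s) * d * q ^ n := by
    intro n
    -- On the event that customer `n` is last, the integrand is a product of one function of each
    -- gap: the idle period `X 0`, then `n` short gaps, then the long gap `X (n + 1)`. The
    -- indicators make the product vanish off that event.
    let φ : ℕ → ℝ → ℂ := fun i => if i = 0 then fun x => Complex.exp (-s * x) else
      if i ≤ n then (Set.Iio b).indicator (fun x => Complex.exp (-z * x)) else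
        (Set.Ici b).indicator (fun _ => Complex.exp (-z * b))
    have hφ0 : φ 0 = fun x : ℝ => Complex.exp (-s * x) := by simp [φ]
    have hφm : ∀ i < n, φ (i + 1) = (Set.Iio b).indicator
        (fun x : ℝ => Complex.exp (-z * x)) := fun i hi => by
      simp [φ, Nat.succ_le_of_lt hi]
    have hφl : φ (n + 1) = (Set.Ici b).indicator (fun _ => Complex.exp (-z * b)) := by simp [φ]
    have hφ : ∀ i, Measurable (φ i) := by
      intro i
      dsimp only [φ]
      split_ifs
      · fun_prop
      · exact Measurable.indicator (by fun_prop) measurableSet_Iio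
      · exact Measurable.indicator (by fun_prop) measurableSet_Ici
    have h1 := h.integral_prod_range (n + 2) hφ
    rw [← integral_indicator (measurableSet_lastCustomer b h.measurable n)]
    have h2 : ∫ w, (lastCustomer b X n).indicator f w ∂μ =
        ∫ w, ∏ i ∈ Finset.range (n + 2), φ i (X i w) ∂μ := by
      refine integral_congr_ae ?_
      filter_upwards [h.ae_gap_pos] with w hpos
      rw [Finset.prod_range_succ, Finset.prod_range_succ', hφ0, hφl]
      by_cases hw : w ∈ lastCustomer b X n
      · rw [Set.indicator_of_mem hw, Set.indicator_of_mem (by exact hw.2)]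
        have h3 : ∏ i ∈ Finset.range n, φ (i + 1) (X (i + 1) w) =
            ∏ i ∈ Finset.range n, Complex.exp (-z * X (i + 1) w) := by
          refine Finset.prod_congr rfl fun i hi => ?_
          rw [hφm i (Finset.mem_range.1 hi), Set.indicator_of_mem]
          exact hw.1 i (Finset.mem_range.1 hi)
        have h4 : 0 ≤ ∑ i ∈ Finset.range n, X (i + 1) w :=
          Finset.sum_nonneg fun i _ => (hpos _).le
        rw [h3, ← Complex.exp_sum, hf]
        simp only
        rw [undisturbed_eq hpos hw, epoch_eq_add_sum, add_sub_cancel_left,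
          ENNReal.toReal_ofReal (by linarith), ← Complex.exp_add, ← Complex.exp_add,
          ← Complex.exp_add, ← Finset.mul_sum]
        congr 1
        push_cast
        ring
      · rw [Set.indicator_of_notMem hw]
        by_cases h3 : b ≤ X (n + 1) w
        · have h4 : ∃ i < n, b ≤ X (i + 1) w := by
            by_contra! h5
            exact hw ⟨h5, h3⟩
          obtain ⟨i, hi, h5⟩ := h4
          rw [Finset.prod_eq_zero (Finset.mem_range.2 hi)]
          · simp
          · rw [hφm i hi, Set.indicator_of_notMem (by simpa using h5)]
        · rw [Set.indicator_of_notMem (s := Set.Ici b) (by simpa using h3), mul_zero]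
    rw [h2, h1, Finset.prod_range_succ, Finset.prod_range_succ', hφ0, hφl,
      integral_exp_expMeasure hr hs, integral_indicator measurableSet_Ici, setIntegral_const,
      measureReal_expMeasure_Ici hr hb]
    have h3 : ∏ i ∈ Finset.range n, ∫ x, φ (i + 1) x ∂(expMeasure r) = q ^ n := by
      rw [Finset.prod_congr rfl (g := fun _ => q), Finset.prod_const, Finset.card_range]
      intro i hi
      rw [hφm i (Finset.mem_range.1 hi), integral_indicator measurableSet_Iio,
        setIntegral_exp_Iio hr hb hzr]
    have h4 : d = Real.exp (-(r * b)) * Complex.exp (-z * b) := by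
      rw [hd]; push_cast
      rw [← Complex.exp_add]; ring_nf
    rw [h3, Complex.real_smul, h4]
    ring
  simp_rw [hterm] at hsum
  have hd0 : d ≠ 0 := Complex.exp_ne_zero _
  have hr0 : (r : ℂ) ≠ 0 := by exact_mod_cast hr.ne'
  have hc0 : (r : ℂ) / (r + s) * d ≠ 0 := mul_ne_zero (div_ne_zero hr0 hsr) hd0
  -- No estimate of `q` is needed: the series over the events converges because the integrand is
  -- integrable, and a geometric series converges only for ratio of norm below `1`. This also makes
  -- the denominator non-zero.
  have hq1 : ‖q‖ < 1 := by
    rw [← summable_geometric_iff_norm_lt_one]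
    exact (summable_mul_left_iff hc0).1 hsum.summable
  have hres := hsum.unique ((hasSum_geometric_of_norm_lt_one hq1).mul_left _)
  have hq0 : 1 - q ≠ 0 := fun h0 => by
    have : q = 1 := by linear_combination -h0
    rw [this] at hq1; simp at hq1
  have hinv : Complex.exp ((r + z) * b) = d⁻¹ := by
    rw [hd, ← Complex.exp_neg]; ring_nf
  have hden : 1 - q = (z + r * d) / (z + r) := by
    rw [hq]; field_simp; ring
  rw [hden] at hq0
  have hzd : z + r * d ≠ 0 := fun h0 => hq0 (by rw [h0, zero_div])
  have hzd' : r + z * d⁻¹ ≠ 0 := fun h0 => hzd (by field_simp at h0; linear_combination h0)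
  rw [hinv]
  refine ⟨hzd', hres.trans ?_⟩
  rw [hden]
  have h5 : (z + r * d) = (r + z * d⁻¹) * d := by field_simp; ring
  rw [h5]
  field_simp
  ring

/-! ### The busy period with catastrophes and its transforms. -/

theorem numInSystem_eq_zero_iff {Ω : Type*} {nu b : ℝ} {X Y : ℕ → Ω → ℝ} {t : ℝ} {w : Ω} :
    numInSystem nu b X Y t w = 0 ↔ ∀ n, epoch X n w ≤ t → t < epoch X n w + b →
      ∃ c ∈ catastropheTimes nu Y w, epoch X n w < c ∧ c ≤ t := by
  rw [numInSystem, Set.encard_eq_zero, Set.eq_empty_iff_forall_notMem]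
  refine forall_congr' fun n => ?_
  rw [Set.mem_ofPred_eq]
  push Not
  rfl

/-- The busy period as a function of the gaps. -/
noncomputable def busyTime {Ω : Type*} (nu b : ℝ) (X Y : ℕ → Ω → ℝ) (w : Ω) : ℝ :=
  (min (undisturbed b X w) (residual nu Y (epoch X 0 w) w)).toReal

/-- At an empty time `t`, the last arrival up to `t` has left. If his service is over, the gap after
him is at least `b` and `undisturbed` has elapsed; otherwise a catastrophe has removed him and
`residual` has elapsed. Ties are excluded so that the infimum is attained: after a gap equal to `b`
the next customer would enter just as the last one leaves, and a customer arriving exactly at a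
catastrophe would survive it. -/
theorem isLeast_emptyTimes {Ω : Type*} {nu b : ℝ} {X Y : ℕ → Ω → ℝ} {w : Ω} (hb : 0 ≤ b)
    (hX : ∀ n, 0 < X n w) (hXlim : Tendsto (fun n => epoch X n w) atTop atTop)
    (hXb : ∀ n, X n w ≠ b) {N : ℕ} (hN : w ∈ lastCustomer b X N)
    (hY : 0 < nu → (∀ n, 0 < Y n w) ∧ Tendsto (fun n => epoch Y n w) atTop atTop)
    (hXY : 0 < nu → ∀ n k, epoch X n w ≠ epoch Y k w) :
    IsLeast (emptyTimes nu b X Y w) (epoch X 0 w + busyTime nu b X Y w) := by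
  have hmono := strictMono_epoch hX
  have h0 : ∀ n, epoch X 0 w ≤ epoch X n w := fun n => hmono.monotone (Nat.zero_le n)
  refine ⟨⟨le_add_of_nonneg_right ENNReal.toReal_nonneg, numInSystem_eq_zero_iff.2 ?_⟩, ?_⟩
  · have hu := undisturbed_eq hX hN
    rcases le_total (undisturbed b X w) (residual nu Y (epoch X 0 w) w) with hle | hle
    · rw [busyTime, min_eq_left hle, hu, ENNReal.toReal_ofReal (by linarith [h0 N])]
      intro n hn1 hn2
      exfalso
      rcases le_or_gt n N with h1 | h1
      · have : epoch X n w ≤ epoch X N w := hmono.monotone h1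
        linarith
      · have h2 : epoch X (N + 1) w ≤ epoch X n w := hmono.monotone h1
        have h3 := lt_of_le_of_ne hN.2 (hXb (N + 1)).symm
        rw [epoch_succ] at h2
        linarith
    · have hnu : 0 < nu := by
        by_contra hnu
        rw [residual_of_rate_zero hnu, hu] at hle
        exact absurd hle (not_le.2 ENNReal.ofReal_lt_top)
      obtain ⟨k, hk1, hk2, -⟩ := exists_residual_eq hnu (hY hnu).1 (hY hnu).2 (epoch X 0 w)
      rw [busyTime, min_eq_right hle, hk2, ENNReal.toReal_ofReal (by linarith), add_sub_cancel]
      exact fun n hn1 _ => ⟨_, ⟨hnu, k, rfl⟩, lt_of_le_of_ne hn1 (hXY hnu n k), le_rfl⟩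
  · rintro t ⟨ht0, ht⟩
    rw [numInSystem_eq_zero_iff] at ht
    obtain ⟨n, hn1, hn2⟩ := exists_le_lt_succ hXlim ht0
    by_cases hd : t < epoch X n w + b
    · obtain ⟨c, ⟨hnu, k, rfl⟩, hc1, hc2⟩ := ht n hn1 hd
      have h1 : residual nu Y (epoch X 0 w) w ≤ ENNReal.ofReal (t - epoch X 0 w) := by
        refine (iInf_le _ k).trans ?_
        rw [if_pos ⟨hnu, (h0 n).trans_lt hc1⟩]
        exact ENNReal.ofReal_le_ofReal (by linarith)
      have h2 := ENNReal.toReal_le_of_le_ofReal (by linarith)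
        ((min_le_right (undisturbed b X w) _).trans h1)
      rw [busyTime]
      linarith
    · have h1 : undisturbed b X w ≤ ENNReal.ofReal (t - epoch X 0 w) := by
        refine (iInf_le _ n).trans ?_
        rw [epoch_succ] at hn2
        rw [if_pos (by linarith)]
        exact ENNReal.ofReal_le_ofReal (by linarith)
      have h2 := ENNReal.toReal_le_of_le_ofReal (by linarith)
        ((min_le_left _ (residual nu Y (epoch X 0 w) w)).trans h1)
      rw [busyTime]
      linarith

theorem IsExpGaps.ae_gap_ne {Ω : Type*} [MeasurableSpace Ω] {μ : Measure Ω} {r : ℝ}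
    {G : ℕ → Ω → ℝ} (h : IsExpGaps μ r G) (b : ℝ) : ∀ᵐ w ∂μ, ∀ n, G n w ≠ b := by
  rw [ae_all_iff]
  intro n
  refine ae_of_ae_map (p := fun x => x ≠ b) (h.measurable n).aemeasurable ?_
  rw [h.law, ae_iff]
  simp

/-- A catastrophe epoch has a density, so it hits a fixed `u` with probability `0`; by independence
`u` may be replaced by an arrival epoch. -/
theorem IsPoissonInput.ae_epoch_ne {Ω : Type*} [MeasurableSpace Ω] {μ : Measure Ω}
    [IsProbabilityMeasure μ] {lam nu : ℝ} {X Y : ℕ → Ω → ℝ} (h : IsPoissonInput μ lam nu X Y)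
    (hnu : 0 < nu) : ∀ᵐ w ∂μ, ∀ n k, epoch X n w ≠ epoch Y k w := by
  rw [ae_all_iff]
  intro n
  rw [ae_all_iff]
  intro k
  have hXm := measurable_epoch h.measurable_arrival n
  have hYm := measurable_epoch h.measurable_catastrophe k
  have hind : IndepFun (epoch X n) (epoch Y k) μ :=
    h.indepFun.comp (measurable_epoch (G := fun i (x : ℕ → ℝ) => x i)
      (fun i => measurable_pi_apply i) n) (measurable_epoch (G := fun i (x : ℕ → ℝ) => x i)
      (fun i => measurable_pi_apply i) k)
  have hD : MeasurableSet {p : ℝ × ℝ | p.1 = p.2} :=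
    measurableSet_eq_fun measurable_fst measurable_snd
  have h1 := lintegral_indepFun (F := fun u v => {p : ℝ × ℝ | p.1 = p.2}.indicator 1 (u, v))
    hXm hYm hind (measurable_one.indicator hD)
  have h2 : ∀ u : ℝ, ∫⁻ v, {p : ℝ × ℝ | p.1 = p.2}.indicator 1 (u, v) ∂(μ.map (epoch Y k)) =
      0 := by
    intro u
    have hs : Measurable (({u} : Set ℝ).indicator (1 : ℝ → ENNReal)) :=
      measurable_one.indicator (measurableSet_singleton u)
    have h3 : (fun v => {p : ℝ × ℝ | p.1 = p.2}.indicator (1 : ℝ × ℝ → ENNReal) (u, v)) =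
        ({u} : Set ℝ).indicator 1 := by
      ext v; simp [Set.indicator_apply, eq_comm]
    rw [h3, lintegral_map hs hYm, (h.catastrophes hnu).lintegral_epoch k hs]
    refine lintegral_eq_zero_of_ae_eq_zero ?_
    have h4 : ∀ᵐ x : ℝ ∂(volume.restrict (Set.Ioi 0)), x ≠ u :=
      ae_restrict_of_ae (by simp [ae_iff])
    filter_upwards [h4] with x hx
    simp [hx]
  simp_rw [h2, lintegral_zero] at h1
  rw [ae_iff]
  have h5 : MeasurableSet {w | epoch X n w = epoch Y k w} := measurableSet_eq_fun hXm hYm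
  have h6 : {w | ¬ epoch X n w ≠ epoch Y k w} = {w | epoch X n w = epoch Y k w} := by
    ext; simp
  rw [h6, ← lintegral_indicator_one h5]
  exact h1

/-- Almost surely the busy period ends, after the time `busyTime`. -/
theorem IsPoissonInput.ae_isLeast_emptyTimes {Ω : Type*} [MeasurableSpace Ω] {μ : Measure Ω}
    [IsProbabilityMeasure μ] {lam nu b : ℝ} {X Y : ℕ → Ω → ℝ} (h : IsPoissonInput μ lam nu X Y)
    (hb : 0 ≤ b) :
    ∀ᵐ w ∂μ, IsLeast (emptyTimes nu b X Y w) (epoch X 0 w + busyTime nu b X Y w) := by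
  have hX := h.arrivals
  by_cases hnu : 0 < nu
  · have hY := h.catastrophes hnu
    filter_upwards [hX.ae_gap_pos, hX.ae_tendsto_epoch, hX.ae_gap_ne b,
      hX.ae_exists_lastCustomer hb, hY.ae_gap_pos, hY.ae_tendsto_epoch, h.ae_epoch_ne hnu]
      with w h1 h2 h3 ⟨N, h4⟩ h5 h6 h7
    exact isLeast_emptyTimes hb h1 h2 h3 h4 (fun _ => ⟨h5, h6⟩) fun _ => h7
  · filter_upwards [hX.ae_gap_pos, hX.ae_tendsto_epoch, hX.ae_gap_ne b,
      hX.ae_exists_lastCustomer hb] with w h1 h2 h3 ⟨N, h4⟩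
    exact isLeast_emptyTimes hb h1 h2 h3 h4 (fun h => absurd h hnu) fun h => absurd h hnu

theorem IsPoissonInput.busyPeriod_ae_eq {Ω : Type*} [MeasurableSpace Ω] {μ : Measure Ω}
    [IsProbabilityMeasure μ] {lam nu b : ℝ} {X Y : ℕ → Ω → ℝ} (h : IsPoissonInput μ lam nu X Y)
    (hb : 0 ≤ b) : busyPeriod nu b X Y =ᵐ[μ] busyTime nu b X Y := by
  filter_upwards [h.ae_isLeast_emptyTimes hb] with w hw
  rw [busyPeriod, hw.csInf_eq, add_sub_cancel_left]

theorem measurable_busyTime {Ω : Type*} [MeasurableSpace Ω] (nu b : ℝ) {X Y : ℕ → Ω → ℝ}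
    (hX : ∀ n, Measurable (X n)) (hY : ∀ n, Measurable (Y n)) :
    Measurable (busyTime nu b X Y) :=
  ((measurable_undisturbed b hX).min ((measurable_residual nu).comp
    ((measurable_epoch hX 0).prodMk (measurable_pi_lambda _ hY)))).ennreal_toReal

theorem integrable_exp_mul_exp {Ω : Type*} [MeasurableSpace Ω] {μ : Measure Ω}
    [IsFiniteMeasure μ] {U V : Ω → ℝ} (hU : Measurable U) (hV : Measurable V)
    (hU0 : ∀ᵐ w ∂μ, 0 ≤ U w) (hV0 : ∀ᵐ w ∂μ, 0 ≤ V w) {s z : ℂ} (hs : 0 ≤ s.re) (hz : 0 ≤ z.re) :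
    Integrable (fun w => Complex.exp (-s * U w) * Complex.exp (-z * V w)) μ := by
  refine Integrable.mono' (g := fun _ => 1) (integrable_const _)
    (by fun_prop) ?_
  filter_upwards [hU0, hV0] with w h1 h2
  rw [← Complex.exp_add, Complex.norm_exp, Real.exp_le_one_iff]
  have h1 := mul_nonneg hs h1
  have h2 := mul_nonneg hz h2
  simp only [neg_mul, Complex.add_re, Complex.neg_re, Complex.re_mul_ofReal]
  linarith

/-- The joint transform of the first idle period and the busy period. -/
theorem IsPoissonInput.integral_exp_busyTime {Ω : Type*} [MeasurableSpace Ω] {μ : Measure Ω}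
    [IsProbabilityMeasure μ] {lam nu b : ℝ} {X Y : ℕ → Ω → ℝ} (h : IsPoissonInput μ lam nu X Y)
    (hb : 0 ≤ b) {p s : ℂ} (hp : 0 ≤ p.re) (hs : 0 ≤ s.re) :
    ∫ w, Complex.exp (-p * X 0 w) * Complex.exp (-s * busyTime nu b X Y w) ∂μ =
      lam / (lam + p) * ((lam + s + nu * Complex.exp ((lam + s + nu) * b)) /
          (lam + (s + nu) * Complex.exp ((lam + s + nu) * b))) := by
  have hX := h.arrivals
  have hXp := measurable_pi_lambda _ h.measurable_arrival
  have hYp := measurable_pi_lambda _ h.measurable_catastrophe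
  have hlam0 : (lam : ℂ) ≠ 0 := by exact_mod_cast h.rate_pos.ne'
  have hX0 : ∀ᵐ w ∂μ, 0 ≤ X 0 w := hX.ae_gap_pos.mono fun w hw => (hw 0).le
  have hfirst : ∫ w, Complex.exp (-p * X 0 w) ∂μ = lam / (lam + p) := by
    rw [← integral_exp_expMeasure h.rate_pos hp, ← h.law_arrival 0,
      integral_map (h.measurable_arrival 0).aemeasurable (by fun_prop)]
  -- The identity below is obtained after multiplication by `s + nu`. This factor vanishes only for
  -- `s = nu = 0`, where the busy-period factor is `1` on both sides.
  by_cases hsn : s + nu = 0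
  · have h1 : nu = 0 := by
      have := congrArg Complex.re hsn
      simp at this
      linarith [h.rate_nonneg]
    have h2 : s = 0 := by simpa [h1] using hsn
    simp [h1, h2, hlam0] at hfirst ⊢
    exact hfirst
  have hnu : 0 ≤ (s + nu : ℂ).re := by
    simpa using add_nonneg hs h.rate_nonneg
  obtain ⟨hne, hund⟩ := hX.integral_exp_undisturbed hb hp hnu
  -- The integrand as a function of the two gap sequences, so that the catastrophes can be
  -- integrated out with the arrivals frozen.
  let F : (ℕ → ℝ) → (ℕ → ℝ) → ℂ := fun x y => Complex.exp (-p * x 0) *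
    Complex.exp (-s * (min (undisturbed b (fun i x => x i) x)
      (residual nu (fun i y => y i) (epoch (fun i x => x i) 0 x) y)).toReal)
  have hF : Measurable (Function.uncurry F) := by
    have h1 : Measurable fun q : (ℕ → ℝ) × (ℕ → ℝ) => undisturbed b (fun i x => x i) q.1 :=
      (measurable_undisturbed b (fun n => measurable_pi_apply n)).comp measurable_fst
    have h2 : Measurable fun q : (ℕ → ℝ) × (ℕ → ℝ) =>
        residual nu (fun i y => y i) (epoch (fun i x => x i) 0 q.1) q.2 :=
      (measurable_residual nu).comp (((measurable_epoch (fun n => measurable_pi_apply n) 0).comp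
        measurable_fst).prodMk measurable_snd)
    have h3 := (h1.min h2).ennreal_toReal
    have h4 : Measurable fun q : (ℕ → ℝ) × (ℕ → ℝ) => q.1 0 :=
      (measurable_pi_apply 0).comp measurable_fst
    simp only [F, Function.uncurry_def]
    fun_prop
  have hint : Integrable (fun w => Complex.exp (-p * X 0 w) *
      Complex.exp (-s * busyTime nu b X Y w)) μ :=
    integrable_exp_mul_exp (h.measurable_arrival 0)
      (measurable_busyTime nu b h.measurable_arrival h.measurable_catastrophe) hX0
      (Eventually.of_forall fun w => ENNReal.toReal_nonneg) hp hs
  have hfreeze : ∫ w, Complex.exp (-p * X 0 w) * Complex.exp (-s * busyTime nu b X Y w) ∂μ =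
      ∫ w, Complex.exp (-p * X 0 w) * ∫ w', Complex.exp (-s * (min (undisturbed b X w)
        (residual nu Y (epoch X 0 w) w')).toReal) ∂μ ∂μ := by
    have h1 := integral_indepFun hXp hYp h.indepFun hF hint
    refine h1.trans ?_
    congr 1; ext w
    exact integral_const_mul _ _
  -- The residual time from the first arrival, censored at the frozen undisturbed period:
  -- exponential killing at rate `nu` shifts the argument of its transform from `s` to `s + nu`.
  have hinner : ∀ᵐ w ∂μ, (s + nu) * (Complex.exp (-p * X 0 w) *
      ∫ w', Complex.exp (-s * (min (undisturbed b X w)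
        (residual nu Y (epoch X 0 w) w')).toReal) ∂μ) =
      nu * Complex.exp (-p * X 0 w) + s * (Complex.exp (-p * X 0 w) *
        Complex.exp (-(s + nu) * (undisturbed b X w).toReal)) := by
    filter_upwards [hX0, hX.ae_gap_pos, hX.ae_exists_lastCustomer hb] with w h0 hpos ⟨N, hN⟩
    have h1 := undisturbed_eq hpos hN
    have h2 : ENNReal.ofReal (undisturbed b X w).toReal = undisturbed b X w := by
      rw [ENNReal.ofReal_toReal]; rw [h1]; exact ENNReal.ofReal_ne_top
    have h3 := h.integral_exp_min_residual (a := epoch X 0 w) (by rwa [epoch_zero])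
      (ENNReal.toReal_nonneg (a := undisturbed b X w)) hs
    rw [h2] at h3
    rw [mul_left_comm, h3]
    ring
  have hi1 : Integrable (fun w => Complex.exp (-p * X 0 w)) μ := by
    have := integrable_exp_mul_exp (s := p) (z := 0) (h.measurable_arrival 0) measurable_const hX0
      (Eventually.of_forall fun w => le_refl (0 : ℝ)) hp le_rfl
    simpa using this
  have hi2 : Integrable (fun w => Complex.exp (-p * X 0 w) *
      Complex.exp (-(s + nu) * (undisturbed b X w).toReal)) μ :=
    integrable_exp_mul_exp (h.measurable_arrival 0)
      (measurable_undisturbed b h.measurable_arrival).ennreal_toReal hX0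
      (Eventually.of_forall fun w => ENNReal.toReal_nonneg) hp hnu
  have hmain : (s + nu) * ∫ w, Complex.exp (-p * X 0 w) *
      Complex.exp (-s * busyTime nu b X Y w) ∂μ =
      nu * (lam / (lam + p)) + s * (lam / (lam + p) * ((lam + (s + nu)) /
        (lam + (s + nu) * Complex.exp ((lam + (s + nu)) * b)))) := by
    rw [hfreeze, ← integral_const_mul, integral_congr_ae hinner,
      integral_add (hi1.const_mul _) (hi2.const_mul _), integral_const_mul, integral_const_mul,
      hund, hfirst]
  rw [add_assoc (lam : ℂ) s nu] at *
  set W := Complex.exp ((lam + (s + nu)) * b)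
  refine mul_left_cancel₀ hsn (hmain.trans ?_)
  field_simp
  ring

theorem IsPoissonInput.lst_busyPeriod {Ω : Type*} [MeasurableSpace Ω] {μ : Measure Ω}
    [IsProbabilityMeasure μ] {lam nu b : ℝ} {X Y : ℕ → Ω → ℝ} (h : IsPoissonInput μ lam nu X Y)
    (hb : 0 ≤ b) {s : ℂ} (hs : 0 ≤ s.re) :
    lst μ (busyPeriod nu b X Y) s =
      (lam + s + nu * Complex.exp ((lam + s + nu) * b)) /
          (lam + (s + nu) * Complex.exp ((lam + s + nu) * b)) := by
  have h1 := h.integral_exp_busyTime hb (p := 0) le_rfl hs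
  have hlam0 : (lam : ℂ) ≠ 0 := by exact_mod_cast h.rate_pos.ne'
  rw [add_zero, div_self hlam0, one_mul] at h1
  rw [← h1, lst]
  refine integral_congr_ae ?_
  filter_upwards [h.busyPeriod_ae_eq hb] with w hw
  simp [hw]

/-- A by-product of the convergent geometric series for the undisturbed busy period, at `z = s +
nu`. -/
theorem IsPoissonInput.denominator_ne_zero {Ω : Type*} [MeasurableSpace Ω] {μ : Measure Ω}
    [IsProbabilityMeasure μ] {lam nu b : ℝ} {X Y : ℕ → Ω → ℝ} (h : IsPoissonInput μ lam nu X Y)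
    (hb : 0 ≤ b) {s : ℂ} (hs : 0 ≤ s.re) :
    lam + (s + nu) * Complex.exp ((lam + s + nu) * b) ≠ 0 := by
  have hnu : 0 ≤ (s + nu : ℂ).re := by
    simpa using add_nonneg hs h.rate_nonneg
  rw [add_assoc (lam : ℂ) s nu]
  exact (h.arrivals.integral_exp_undisturbed hb (s := 0) le_rfl hnu).1

theorem IsPoissonInput.lst_busyCycle {Ω : Type*} [MeasurableSpace Ω] {μ : Measure Ω}
    [IsProbabilityMeasure μ] {lam nu b : ℝ} {X Y : ℕ → Ω → ℝ} (h : IsPoissonInput μ lam nu X Y)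
    (hb : 0 ≤ b) {s : ℂ} (hs : 0 ≤ s.re) :
    lst μ (busyCycle nu b X Y) s =
      1 - s * (lam + s + nu) * Complex.exp ((lam + s + nu) * b) /
          ((lam + s) * (lam + (nu + s) * Complex.exp ((lam + s + nu) * b))) := by
  have h1 := h.integral_exp_busyTime hb hs hs
  have hden := h.denominator_ne_zero hb hs
  have hls : (lam : ℂ) + s ≠ 0 := fun h0 => by
    have := congrArg Complex.re h0
    simp at this; linarith [h.rate_pos]
  have h2 : lst μ (busyCycle nu b X Y) s =
      ∫ w, Complex.exp (-s * X 0 w) * Complex.exp (-s * busyTime nu b X Y w) ∂μ := by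
    refine integral_congr_ae ?_
    filter_upwards [h.busyPeriod_ae_eq hb] with w hw
    rw [← Complex.exp_add, busyCycle, hw, epoch_zero]
    push_cast
    ring_nf
  rw [h2, h1, add_comm (nu : ℂ) s, div_mul_div_comm, eq_sub_iff_add_eq, ← add_div,
    div_eq_one_iff_eq (mul_ne_zero hls hden)]
  ring

/-! ### The probability that the system is empty. -/

theorem measurableSet_no_catastrophe (nu t : ℝ) :
    MeasurableSet {p : ℝ × (ℕ → ℝ) |
      ∀ c ∈ catastropheTimes nu (fun i y => y i) p.2, ¬ (p.1 < c ∧ c ≤ t)} := by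
  have h1 : ∀ k, Measurable fun p : ℝ × (ℕ → ℝ) => epoch (fun i y => y i) k p.2 := fun k =>
    (measurable_epoch (fun i => measurable_pi_apply i) k).comp measurable_snd
  have h2 : {p : ℝ × (ℕ → ℝ) |
      ∀ c ∈ catastropheTimes nu (fun i y => y i) p.2, ¬ (p.1 < c ∧ c ≤ t)} =
      ⋂ k, {p | 0 < nu ∧ p.1 < epoch (fun i y => y i) k p.2 ∧
        epoch (fun i y => y i) k p.2 ≤ t}ᶜ := by
    ext p
    simp only [catastropheTimes, Set.mem_ofPred_eq, Set.mem_iInter, Set.mem_compl_iff]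
    constructor
    · exact fun H k hk => H _ ⟨hk.1, k, rfl⟩ hk.2
    · rintro H c ⟨hnu, k, rfl⟩ hc
      exact H k ⟨hnu, hc⟩
  rw [h2]
  exact MeasurableSet.iInter fun k => ((MeasurableSet.const _).inter
    ((measurableSet_lt measurable_fst (h1 k)).inter
      (measurableSet_le (h1 k) measurable_const))).compl

theorem measurableSet_numInSystem_eq_zero {Ω : Type*} [MeasurableSpace Ω] {nu b : ℝ}
    {X Y : ℕ → Ω → ℝ} (hX : ∀ n, Measurable (X n)) (hY : ∀ n, Measurable (Y n)) (t : ℝ) :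
    MeasurableSet {w | numInSystem nu b X Y t w = 0} := by
  have h1 : {w | numInSystem nu b X Y t w = 0} = ⋂ n, ({w | epoch X n w ≤ t} ∩
      ({w | t < epoch X n w + b} ∩ {w | ∀ c ∈ catastropheTimes nu Y w,
        ¬ (epoch X n w < c ∧ c ≤ t)}))ᶜ := by
    ext w
    rw [Set.mem_ofPred_eq, numInSystem, Set.encard_eq_zero, Set.eq_empty_iff_forall_notMem]
    simp only [Set.mem_iInter, Set.mem_compl_iff]
    rfl
  rw [h1]
  have hm := measurable_epoch hX
  exact MeasurableSet.iInter fun n => ((measurableSet_le (hm n) measurable_const).inter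
    ((measurableSet_lt measurable_const ((hm n).add_const b)).inter
      (((hm n).prodMk (measurable_pi_lambda _ hY)) (measurableSet_no_catastrophe nu t)))).compl

/-- If `n` is the last arrival up to time `t`, then the system is nonempty if and only if
customer `n` is present. -/
theorem numInSystem_ne_zero_iff {Ω : Type*} {nu b : ℝ} {X Y : ℕ → Ω → ℝ} {t : ℝ} {w : Ω}
    (hX : ∀ n, 0 < X n w) {n : ℕ} (hn : epoch X n w ≤ t) (hn' : t < epoch X (n + 1) w) :
    numInSystem nu b X Y t w ≠ 0 ↔ t < epoch X n w + b ∧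
      ∀ c ∈ catastropheTimes nu Y w, ¬ (epoch X n w < c ∧ c ≤ t) := by
  have hmono := strictMono_epoch hX
  rw [Ne, numInSystem_eq_zero_iff]
  push Not
  constructor
  -- If an earlier customer is present, so is customer `n`: his service ends no earlier, and every
  -- catastrophe after his arrival also comes after the earlier one.
  · rintro ⟨m, h1, h2, h3⟩
    have hmn : m < n + 1 := hmono.lt_iff_lt.1 (h1.trans_lt hn')
    have h4 : epoch X m w ≤ epoch X n w := hmono.monotone (Nat.lt_succ_iff.1 hmn)
    exact ⟨by linarith, fun c hc hc1 => h3 c hc (h4.trans_lt hc1)⟩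
  · rintro ⟨h1, h2⟩
    exact ⟨n, hn, h1, h2⟩

/-- The probability that at time `t` the last arrival is customer `n`, and he is present. -/
theorem IsPoissonInput.lintegral_last_present {Ω : Type*} [MeasurableSpace Ω] {μ : Measure Ω}
    [IsProbabilityMeasure μ] {lam nu b : ℝ} {X Y : ℕ → Ω → ℝ} (h : IsPoissonInput μ lam nu X Y)
    (t : ℝ) (n : ℕ) :
    ∫⁻ w, {w | epoch X n w ≤ t ∧ t < epoch X (n + 1) w}.indicator
      ({w | numInSystem nu b X Y t w = 0}ᶜ.indicator 1) w ∂μ =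
    ∫⁻ w, (Set.Ioc (t - b) t).indicator
      (fun u => ENNReal.ofReal (Real.exp (-((lam + nu) * (t - u))))) (epoch X n w) ∂μ := by
  classical
  have hX := h.arrivals
  have hXm := measurable_epoch h.measurable_arrival
  have hYp := measurable_pi_lambda _ h.measurable_catastrophe
  let S : Set (ℝ × ℝ) := {u | u.1 ∈ Set.Ioc (t - b) t ∧ t - u.1 < u.2}
  have hS : MeasurableSet S := (measurable_fst measurableSet_Ioc).inter
    (measurableSet_lt (measurable_const.sub measurable_fst) measurable_snd)
  let R : Set (ℝ × (ℕ → ℝ)) := {p | ∀ c ∈ catastropheTimes nu (fun i y => y i) p.2,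
    ¬ (p.1 < c ∧ c ≤ t)}
  have hR : MeasurableSet R := measurableSet_no_catastrophe nu t
  -- The event factors into a condition `S` on the arrival epoch and the next gap, and a condition
  -- `R` on the catastrophes. Integrating out the catastrophes gives the factor with rate `nu`, and
  -- then the next gap gives the one with rate `lam`.
  let F : ℝ × ℝ → (ℕ → ℝ) → ENNReal := fun u y => S.indicator 1 u * R.indicator 1 (u.1, y)
  have hF : Measurable (Function.uncurry F) :=
    ((measurable_one.indicator hS).comp measurable_fst).mul
      ((measurable_one.indicator hR).comp
        ((measurable_fst.comp measurable_fst).prodMk measurable_snd))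
  have h1 : ∫⁻ w, {w | epoch X n w ≤ t ∧ t < epoch X (n + 1) w}.indicator
      ({w | numInSystem nu b X Y t w = 0}ᶜ.indicator 1) w ∂μ =
      ∫⁻ w, F (epoch X n w, X (n + 1) w) (fun i => Y i w) ∂μ := by
    refine lintegral_congr_ae ?_
    filter_upwards [hX.ae_gap_pos] with w hpos
    have hs := epoch_succ X n w
    simp only [F, Set.indicator_apply, Set.mem_ofPred_eq, Set.mem_compl_iff, S, R, Set.mem_Ioc]
    by_cases hc : epoch X n w ≤ t ∧ t < epoch X (n + 1) w
    · have h2 := numInSystem_ne_zero_iff (nu := nu) (b := b) (Y := Y) hpos hc.1 hc.2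
      rw [if_pos hc]
      by_cases hd : t < epoch X n w + b
      · rw [if_pos (c := (_ ∧ _) ∧ _) ⟨⟨by linarith, hc.1⟩, by linarith [hc.2]⟩]
        simp only [Pi.one_apply, one_mul]
        refine if_congr ?_ rfl rfl
        exact h2.trans (and_iff_right hd)
      · rw [if_neg (c := (_ ∧ _) ∧ _) (fun H => hd (by linarith [H.1.1])),
          if_neg (fun H => hd (h2.1 H).1), zero_mul]
    · rw [if_neg hc, if_neg (c := (_ ∧ _) ∧ _), zero_mul]
      exact fun H => hc ⟨H.1.2, by linarith [H.2]⟩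
  have hind : IndepFun (fun w => (epoch X n w, X (n + 1) w)) (fun w i => Y i w) μ :=
    h.indepFun.comp (((measurable_epoch (G := fun i (x : ℕ → ℝ) => x i)
      (fun i => measurable_pi_apply i) n)).prodMk (measurable_pi_apply (n + 1))) measurable_id
  rw [h1, lintegral_indepFun ((hXm n).prodMk (h.measurable_arrival _)) hYp hind hF]
  have h2 : ∫⁻ w, ∫⁻ y, F (epoch X n w, X (n + 1) w) y ∂(μ.map fun w i => Y i w) ∂μ =
      ∫⁻ w, S.indicator 1 (epoch X n w, X (n + 1) w) *
        ENNReal.ofReal (Real.exp (-(nu * (t - epoch X n w)))) ∂μ := by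
    refine lintegral_congr_ae ?_
    filter_upwards [hX.ae_gap_pos] with w hpos
    have hRw : MeasurableSet {y : ℕ → ℝ | (epoch X n w, y) ∈ R} :=
      (measurable_const.prodMk measurable_id) hR
    have h0 : 0 ≤ epoch X n w := Finset.sum_nonneg fun i _ => (hpos i).le
    simp only [F]
    by_cases hw : (epoch X n w, X (n + 1) w) ∈ S
    · rw [Set.indicator_of_mem hw]
      simp only [Pi.one_apply, one_mul]
      have h3 : (fun y => R.indicator (1 : ℝ × (ℕ → ℝ) → ENNReal) (epoch X n w, y)) =
          {y : ℕ → ℝ | (epoch X n w, y) ∈ R}.indicator 1 := by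
        ext y; simp [Set.indicator_apply]
      rw [h3, lintegral_indicator_one hRw, Measure.map_apply hYp hRw,
        ← h.measure_no_catastrophe h0 (sub_nonneg.2 hw.1.2), add_sub_cancel]
      rfl
    · simp [Set.indicator_of_notMem hw]
  rw [h2, lintegral_indepFun (F := fun u v => S.indicator 1 (u, v) *
    ENNReal.ofReal (Real.exp (-(nu * (t - u))))) (hXm n) (h.measurable_arrival _)
    (hX.indepFun_epoch n) ((measurable_one.indicator hS).mul (by fun_prop))]
  congr 1; ext w
  rw [h.law_arrival, lintegral_mul_const]
  · by_cases hw : epoch X n w ∈ Set.Ioc (t - b) t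
    · have h3 : (fun v => S.indicator (1 : ℝ × ℝ → ENNReal) (epoch X n w, v)) =
          (Set.Ioi (t - epoch X n w)).indicator 1 := by
        ext v; simp only [Set.indicator_apply, S, Set.mem_ofPred_eq, hw, true_and, Set.mem_Ioi]; rfl
      rw [Set.indicator_of_mem hw, h3, lintegral_indicator_one measurableSet_Ioi,
        expMeasure_Ioi h.rate_pos (sub_nonneg.2 hw.2), ← ENNReal.ofReal_mul (Real.exp_pos _).le,
        ← Real.exp_add]
      ring_nf
    · have h3 : (fun v => S.indicator (1 : ℝ × ℝ → ENNReal) (epoch X n w, v)) = fun _ => 0 := by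
        ext v; exact Set.indicator_of_notMem (fun H => hw H.1) _
      rw [Set.indicator_of_notMem hw, h3, lintegral_zero, zero_mul]
  · exact (measurable_one.indicator hS).comp (measurable_const.prodMk measurable_id)

/-- The probability that the system is empty at time `t`. -/
theorem IsPoissonInput.idleProb_eq {Ω : Type*} [MeasurableSpace Ω] {μ : Measure Ω}
    [IsProbabilityMeasure μ] {lam nu b : ℝ} {X Y : ℕ → Ω → ℝ} (h : IsPoissonInput μ lam nu X Y)
    (hb : 0 ≤ b) {t : ℝ} (ht : 0 ≤ t) :
    idleProb μ nu b X Y t =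
      1 - lam * ((1 - Real.exp (-((lam + nu) * min t b))) / (lam + nu)) := by
  have hlam := h.rate_pos
  have hnu := h.rate_nonneg
  have hκ : 0 < lam + nu := by linarith
  have hX := h.arrivals
  have hZ := measurableSet_numInSystem_eq_zero (nu := nu) (b := b) h.measurable_arrival
    h.measurable_catastrophe t
  have h1 : μ {w | numInSystem nu b X Y t w = 0}ᶜ =
      ENNReal.ofReal (lam * ((1 - Real.exp (-((lam + nu) * min t b))) / (lam + nu))) := by
    rw [← lintegral_indicator_one hZ.compl,
      hX.lintegral_eq_tsum_last t (measurable_one.indicator hZ.compl)]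
    simp_rw [h.lintegral_last_present t]
    rw [hX.tsum_lintegral_epoch (Measurable.indicator (by fun_prop) measurableSet_Ioc),
      lintegral_indicator measurableSet_Ioc, Measure.restrict_restrict measurableSet_Ioc]
    have h2 : Set.Ioc (t - b) t ∩ Set.Ioi 0 = Set.Ioc (max (t - b) 0) t := by
      ext u; simp only [Set.mem_inter_iff, Set.mem_Ioc, Set.mem_Ioi, max_lt_iff]; tauto
    rw [h2, lintegral_exp_Ioc hκ (max_le (by linarith) ht), ← ENNReal.ofReal_mul hlam.le]
    have h3 : t - max (t - b) 0 = min t b := by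
      rcases le_total t b with h4 | h4
      · rw [max_eq_right (by linarith), min_eq_left h4, sub_zero]
      · rw [max_eq_left (by linarith), min_eq_right h4]; ring
    rw [h3, sub_self, mul_zero, neg_zero, Real.exp_zero]
    -- Before the first arrival the system is empty, so this part contributes nothing.
    have h5 : ∫⁻ w, {w | t < epoch X 0 w}.indicator
        ({w | numInSystem nu b X Y t w = 0}ᶜ.indicator 1) w ∂μ = 0 := by
      refine lintegral_eq_zero_of_ae_eq_zero ?_
      filter_upwards [hX.ae_gap_pos] with w hpos
      by_cases h6 : t < epoch X 0 w
      · rw [Set.indicator_of_mem (by exact h6), Set.indicator_of_notMem]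
        · rfl
        · rw [Set.notMem_compl_iff]
          refine numInSystem_eq_zero_iff.2 fun n hn => ?_
          have : epoch X 0 w ≤ epoch X n w := (strictMono_epoch hpos).monotone (Nat.zero_le n)
          linarith
      · rw [Set.indicator_of_notMem (by exact h6)]; rfl
    rw [h5, zero_add]
  have h2 : μ.real {w | numInSystem nu b X Y t w = 0}ᶜ =
      lam * ((1 - Real.exp (-((lam + nu) * min t b))) / (lam + nu)) := by
    rw [measureReal_def, h1, ENNReal.toReal_ofReal]
    have h3 : Real.exp (-((lam + nu) * min t b)) ≤ 1 :=
      Real.exp_le_one_iff.2 (neg_nonpos.2 (mul_nonneg hκ.le (le_min ht hb)))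
    exact mul_nonneg hlam.le (div_nonneg (by linarith) hκ.le)
  rw [idleProb, ← h2, probReal_compl_eq_one_sub hZ]
  ring

/-! ### The Laplace transform of the idle probability. -/

theorem integrableOn_exp_neg_mul {s : ℂ} (hs : 0 < s.re) (c : ℝ) :
    IntegrableOn (fun t : ℝ => Complex.exp (-s * t)) (Set.Ioi c) :=
  integrableOn_exp_mul_complex_Ioi (by simpa using hs) c

theorem integral_exp_neg_mul_Ioi {s : ℂ} (hs : 0 < s.re) (c : ℝ) :
    ∫ t : ℝ in Set.Ioi c, Complex.exp (-s * t) = Complex.exp (-s * c) / s := by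
  rw [integral_exp_mul_complex_Ioi (by simpa using hs), neg_div_neg_eq]

theorem hasIntegral_exp_mul_exp_min {s : ℂ} (hs : 0 < s.re) {κ b : ℝ} (hκ : 0 < κ) (hb : 0 ≤ b) :
    IntegrableOn (fun t : ℝ => Complex.exp (-s * t) * (Real.exp (-(κ * min t b)) : ℝ))
      (Set.Ioi 0) ∧
    ∫ t : ℝ in Set.Ioi 0, Complex.exp (-s * t) * (Real.exp (-(κ * min t b)) : ℝ) =
      (1 - Complex.exp (-(s + κ) * b)) / (s + κ) + Complex.exp (-(s + κ) * b) / s := by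
  have hsκ : s + κ ≠ 0 := fun h => by
    have := congrArg Complex.re h
    simp at this; linarith
  have hint : IntegrableOn (fun t : ℝ => Complex.exp (-s * t) * (Real.exp (-(κ * min t b)) : ℝ))
      (Set.Ioi 0) := by
    refine Integrable.mono (integrableOn_exp_neg_mul hs 0) (by fun_prop) ?_
    filter_upwards [ae_restrict_mem measurableSet_Ioi] with t ht
    rw [norm_mul, Complex.norm_real, Real.norm_of_nonneg (Real.exp_pos _).le]
    refine mul_le_of_le_one_right (norm_nonneg _) (Real.exp_le_one_iff.2 ?_)
    exact neg_nonpos.2 (mul_nonneg hκ.le (le_min (le_of_lt ht) hb))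
  refine ⟨hint, ?_⟩
  rw [← Set.Ioc_union_Ioi_eq_Ioi hb, setIntegral_union
    (Set.Ioc_disjoint_Ioi le_rfl) measurableSet_Ioi
    (hint.mono_set Set.Ioc_subset_Ioi_self) (hint.mono_set (Set.Ioi_subset_Ioi hb))]
  congr 1
  · have h1 : ∀ t ∈ Set.Ioc 0 b, Complex.exp (-s * t) * (Real.exp (-(κ * min t b)) : ℝ) =
        Complex.exp (-(s + κ) * t) := fun t ht => by
      rw [min_eq_left ht.2]
      push_cast
      rw [← Complex.exp_add]; ring_nf
    rw [setIntegral_congr_fun measurableSet_Ioc h1, ← intervalIntegral.integral_of_le hb,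
      integral_exp_mul_complex (neg_ne_zero.2 hsκ), Complex.ofReal_zero, mul_zero,
      Complex.exp_zero, ← neg_div_neg_eq, neg_sub, neg_neg]
  · have h1 : ∀ t ∈ Set.Ioi b, Complex.exp (-s * t) * (Real.exp (-(κ * min t b)) : ℝ) =
        Complex.exp (-s * t) * (Real.exp (-(κ * b)) : ℝ) := fun t ht => by
      rw [min_eq_right (le_of_lt ht)]
    rw [setIntegral_congr_fun measurableSet_Ioi h1, integral_mul_const,
      integral_exp_neg_mul_Ioi hs, div_mul_eq_mul_div]
    push_cast
    rw [← Complex.exp_add]; ring_nf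

/-- The transform of the idle probability. -/
theorem IsPoissonInput.idleTransform_eq {Ω : Type*} [MeasurableSpace Ω] {μ : Measure Ω}
    [IsProbabilityMeasure μ] {lam nu b : ℝ} {X Y : ℕ → Ω → ℝ} (h : IsPoissonInput μ lam nu X Y)
    (hb : 0 ≤ b) {s : ℂ} (hs : 0 < s.re) :
    IntegrableOn (fun t : ℝ => Complex.exp (-s * t) * (idleProb μ nu b X Y t : ℂ))
        (Set.Ioi 0) ∧
      idleTransform μ nu b X Y s =
        (lam + (s + nu) * Complex.exp ((lam + s + nu) * b)) /
          (s * (lam + s + nu) * Complex.exp ((lam + s + nu) * b)) := by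
  have hκ : 0 < lam + nu := by linarith [h.rate_pos, h.rate_nonneg]
  have hκ0 : (lam : ℂ) + nu ≠ 0 := by exact_mod_cast hκ.ne'
  have hs0 : s ≠ 0 := fun h0 => by rw [h0] at hs; simp at hs
  have hsκ : s + (lam + nu) ≠ 0 := fun h0 => by
    have := congrArg Complex.re h0
    simp at this; linarith
  obtain ⟨hi, hI⟩ := hasIntegral_exp_mul_exp_min hs hκ hb
  have hi1 := (integrableOn_exp_neg_mul hs 0).mul_const ((1 - lam / (lam + nu) : ℝ) : ℂ)
  have hi2 := hi.mul_const ((lam / (lam + nu) : ℝ) : ℂ)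
  have hcongr : Set.EqOn (fun t : ℝ => Complex.exp (-s * t) * (idleProb μ nu b X Y t : ℂ))
      (fun t : ℝ => Complex.exp (-s * t) * ((1 - lam / (lam + nu) : ℝ) : ℂ) +
        Complex.exp (-s * t) * (Real.exp (-((lam + nu) * min t b)) : ℝ) *
          ((lam / (lam + nu) : ℝ) : ℂ)) (Set.Ioi 0) := by
    intro t ht
    simp only
    rw [h.idleProb_eq hb (le_of_lt ht)]
    push_cast
    ring
  refine ⟨(integrableOn_congr_fun hcongr measurableSet_Ioi).2 (hi1.add hi2), ?_⟩
  rw [idleTransform, setIntegral_congr_fun measurableSet_Ioi hcongr, integral_add hi1 hi2,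
    integral_mul_const, integral_mul_const, hI, integral_exp_neg_mul_Ioi hs]
  have h1 : Complex.exp ((lam + s + nu) * b) =
      (Complex.exp (-(s + (lam + nu : ℝ)) * b))⁻¹ := by
    rw [← Complex.exp_neg]; push_cast; ring_nf
  have hd : Complex.exp (-(s + (lam + nu : ℝ)) * b) ≠ 0 := Complex.exp_ne_zero _
  have h2 : (lam : ℂ) + s + nu = s + (lam + nu) := by ring
  rw [h1, h2]
  push_cast at hd ⊢
  generalize Complex.exp (-(s + (lam + nu)) * b) = d at hd ⊢
  rw [mul_zero, Complex.exp_zero]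
  field_simp
  ring

/-- The factor `s` cancels the pole at `0`, and the remaining quotient `g` is continuous there
because `lam + nu` is non-zero. -/
theorem IsPoissonInput.tendsto_mul_idleTransform {Ω : Type*} [MeasurableSpace Ω] {μ : Measure Ω}
    [IsProbabilityMeasure μ] {lam nu b : ℝ} {X Y : ℕ → Ω → ℝ} (h : IsPoissonInput μ lam nu X Y)
    (hb : 0 ≤ b) :
    Tendsto (fun s : ℂ => s * idleTransform μ nu b X Y s) (𝓝[{s : ℂ | 0 < s.re}] 0)
      (𝓝 (((nu + lam * Real.exp (-((lam + nu) * b))) / (nu + lam) : ℝ) : ℂ)) := by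
  have hκ : 0 < lam + nu := by linarith [h.rate_pos, h.rate_nonneg]
  have hκ0 : (lam : ℂ) + nu ≠ 0 := by exact_mod_cast hκ.ne'
  let g : ℂ → ℂ := fun s => (lam + (s + nu) * Complex.exp ((lam + s + nu) * b)) /
    ((lam + s + nu) * Complex.exp ((lam + s + nu) * b))
  have hg : ContinuousAt g 0 := by
    refine ContinuousAt.div (by fun_prop) (by fun_prop) ?_
    simpa using hκ0
  have hg0 : g 0 = (((nu + lam * Real.exp (-((lam + nu) * b))) / (nu + lam) : ℝ) : ℂ) := by
    have h1 : Complex.exp ((lam + nu) * b) = (Complex.exp (-((lam + nu) * b)))⁻¹ := by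
      rw [← Complex.exp_neg, neg_neg]
    have hd : Complex.exp (-((lam + nu) * b)) ≠ 0 := Complex.exp_ne_zero _
    simp only [g]
    push_cast
    rw [add_zero, zero_add, h1, add_comm (nu : ℂ) lam]
    generalize Complex.exp (-((lam + nu) * b)) = d at hd ⊢
    field_simp
    ring
  rw [← hg0]
  refine (hg.mono_left nhdsWithin_le_nhds).congr' ?_
  filter_upwards [self_mem_nhdsWithin] with s hs
  have hs0 : s ≠ 0 := fun h0 => by rw [h0] at hs; simp at hs
  rw [(h.idleTransform_eq hb hs).2, mul_assoc s, ← div_div, mul_comm s, div_mul_eq_mul_div]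
  rw [div_mul_cancel₀ _ hs0]

/-! ### Moments from the transform. -/

/-- If nonnegative minorants of `f` converge to `f`, and their integrals converge, then `f` is
integrable, with the limit as its integral. -/
theorem integrable_and_integral_eq_of_tendsto {Ω : Type*} [MeasurableSpace Ω] {μ : Measure Ω}
    {F : ℕ → Ω → ℝ} {f : Ω → ℝ} {c : ℝ} (hF : ∀ n, Integrable (F n) μ)
    (h0 : ∀ n w, 0 ≤ F n w) (hle : ∀ n w, F n w ≤ f w)
    (hlim : ∀ w, Tendsto (fun n => F n w) atTop (𝓝 (f w)))
    (hc : Tendsto (fun n => ∫ w, F n w ∂μ) atTop (𝓝 c)) :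
    Integrable f μ ∧ ∫ w, f w ∂μ = c := by
  have hf0 : ∀ w, 0 ≤ f w := fun w => (h0 0 w).trans (hle 0 w)
  have hfm : AEStronglyMeasurable f μ :=
    aestronglyMeasurable_of_tendsto_ae atTop (fun n => (hF n).aestronglyMeasurable)
      (Eventually.of_forall hlim)
  have hint : Integrable f μ := by
    refine ⟨hfm, ?_⟩
    rw [hasFiniteIntegral_iff_ofReal (Eventually.of_forall hf0)]
    -- Fatou's lemma bounds the integral of `f` by `c`; afterwards `f` itself dominates the
    -- sequence.
    have h1 : ∫⁻ w, ENNReal.ofReal (f w) ∂μ =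
        ∫⁻ w, liminf (fun n => ENNReal.ofReal (F n w)) atTop ∂μ :=
      lintegral_congr fun w => ((ENNReal.tendsto_ofReal (hlim w)).liminf_eq).symm
    have h2 : ∀ n, ∫⁻ w, ENNReal.ofReal (F n w) ∂μ = ENNReal.ofReal (∫ w, F n w ∂μ) := fun n =>
      (ofReal_integral_eq_lintegral_ofReal (hF n) (Eventually.of_forall (h0 n))).symm
    rw [h1]
    refine (lintegral_liminf_le' fun n => (hF n).aemeasurable.ennreal_ofReal).trans_lt ?_
    simp_rw [h2]
    rw [(ENNReal.tendsto_ofReal hc).liminf_eq]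
    exact ENNReal.ofReal_lt_top
  refine ⟨hint, tendsto_nhds_unique (tendsto_integral_of_dominated_convergence f
    (fun n => (hF n).aestronglyMeasurable) hint (fun n => Eventually.of_forall fun w => ?_)
    (Eventually.of_forall hlim)) hc⟩
  rw [Real.norm_of_nonneg (h0 n w)]
  exact hle n w

/-- Since `(1 - x + x²/2)(1 + x + x²/2) = 1 + x⁴/4 ≥ 1`, the lower bound `1 + x + x²/2 ≤ e^x` gives
the claim. It keeps the second-order quotients of `moments_of_transform` below `T ^ 2`. -/
theorem exp_neg_le_quadratic {x : ℝ} (hx : 0 ≤ x) : Real.exp (-x) ≤ 1 - x + x ^ 2 / 2 := by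
  have h1 := Real.quadratic_le_exp_of_nonneg hx
  have h2 : Real.exp (-x) * Real.exp x = 1 := by rw [← Real.exp_add]; simp
  have h3 : 0 ≤ 1 - x + x ^ 2 / 2 := by nlinarith [sq_nonneg (x - 1)]
  have h4 : 1 ≤ (1 - x + x ^ 2 / 2) * Real.exp x := by
    refine le_trans ?_ (mul_le_mul_of_nonneg_left h1 h3)
    nlinarith [sq_nonneg (x ^ 2)]
  have h5 := Real.exp_pos x
  exact le_of_mul_le_mul_right (h2.trans_le h4) h5

theorem tendsto_exp_neg_second_order (t : ℝ) {u : ℕ → ℝ} (hu : Tendsto u atTop (𝓝[≠] 0)) :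
    Tendsto (fun n => 2 * (Real.exp (-(u n * t)) - 1 + u n * t) / u n ^ 2) atTop
      (𝓝 (t ^ 2)) := by
  have hu0 : Tendsto u atTop (𝓝 0) := hu.mono_right nhdsWithin_le_nhds
  have hne : ∀ᶠ n in atTop, u n ≠ 0 := hu.eventually self_mem_nhdsWithin
  have hsmall : ∀ᶠ n in atTop, |-(u n * t)| ≤ 1 := by
    have h1 : Tendsto (fun n => |-(u n * t)|) atTop (𝓝 |-(0 * t)|) := (hu0.mul_const t).neg.abs
    rw [zero_mul, neg_zero, abs_zero] at h1
    exact (h1.eventually (gt_mem_nhds one_pos)).mono fun n hn => hn.le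
  rw [tendsto_iff_norm_sub_tendsto_zero]
  have hb : Tendsto (fun n => |u n| * |t| ^ 3) atTop (𝓝 0) := by
    simpa using hu0.abs.mul_const (|t| ^ 3)
  refine squeeze_zero' (Eventually.of_forall fun n => norm_nonneg _) ?_ hb
  filter_upwards [hne, hsmall] with n h0 h1
  have h2 := Real.exp_bound h1 (n := 3) (by norm_num)
  simp only [Finset.sum_range_succ, Finset.sum_range_zero, Nat.factorial] at h2
  have h3 : 2 * (Real.exp (-(u n * t)) - 1 + u n * t) / u n ^ 2 - t ^ 2 =
      2 * (Real.exp (-(u n * t)) - (1 + -(u n * t) + (u n * t) ^ 2 / 2)) / u n ^ 2 := by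
    field_simp
    ring
  rw [h3, Real.norm_eq_abs, abs_div, abs_mul, abs_two, abs_of_nonneg (sq_nonneg (u n)),
    div_le_iff₀ (by positivity)]
  -- The constant `4 / 18` is the factor `4 / (3! * 3)` of the Taylor remainder bound at order `3`;
  -- doubled, it is still below `1`.
  have h4 : |Real.exp (-(u n * t)) - (1 + -(u n * t) + (u n * t) ^ 2 / 2)| ≤
      (|u n| * |t|) ^ 3 * (4 / 18) := by
    rw [abs_neg, abs_mul] at h2
    norm_num at h2
    norm_num
    exact h2
  have h5 : |u n| * |t| ^ 3 * u n ^ 2 = (|u n| * |t|) ^ 3 := by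
    rw [← sq_abs (u n)]; ring
  rw [h5]
  have h6 : 0 ≤ (|u n| * |t|) ^ 3 := by positivity
  linarith

/-- The first two moments of a nonnegative variable with transform `1 - σ * g σ`. -/
theorem moments_of_transform {Ω : Type*} [MeasurableSpace Ω] {μ : Measure Ω}
    [IsProbabilityMeasure μ] {T : Ω → ℝ} (hT : Measurable T) (hT0 : ∀ w, 0 ≤ T w) {g : ℝ → ℝ}
    {g' : ℝ} (hg : HasDerivAt g g' 0)
    (htr : ∀ σ, 0 < σ → ∫ w, Real.exp (-(σ * T w)) ∂μ = 1 - σ * g σ) :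
    (Integrable T μ ∧ ∫ w, T w ∂μ = g 0) ∧
      (Integrable (fun w => T w ^ 2) μ ∧ ∫ w, T w ^ 2 ∂μ = -2 * g') := by
  let u : ℕ → ℝ := fun n => 1 / ((n : ℝ) + 1)
  have hupos : ∀ n, 0 < u n := fun n => by positivity
  have hu0 : Tendsto u atTop (𝓝 0) := tendsto_one_div_add_atTop_nhds_zero_nat
  have hu : Tendsto u atTop (𝓝[≠] 0) := tendsto_nhdsWithin_iff.2
    ⟨hu0, Eventually.of_forall fun n => (hupos n).ne'⟩
  have hiexp : ∀ n, Integrable (fun w => Real.exp (-(u n * T w))) μ := fun n => by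
    refine Integrable.mono' (g := fun _ => 1) (integrable_const _) (by fun_prop)
      (Eventually.of_forall fun w => ?_)
    rw [Real.norm_of_nonneg (Real.exp_pos _).le, Real.exp_le_one_iff]
    exact neg_nonpos.2 (mul_nonneg (hupos n).le (hT0 w))
  have hfirst : Integrable T μ ∧ ∫ w, T w ∂μ = g 0 := by
    -- The quotients lie below `T` because `1 - e^{-x} ≤ x`, and their integrals are exactly `g (u
    -- n)`.
    refine integrable_and_integral_eq_of_tendsto
      (F := fun n w => (1 - Real.exp (-(u n * T w))) / u n)
      (fun n => ((integrable_const 1).sub (hiexp n)).div_const _) (fun n w => ?_) (fun n w => ?_)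
      (fun w => ?_) ?_
    · refine div_nonneg (sub_nonneg.2 (Real.exp_le_one_iff.2 ?_)) (hupos n).le
      exact neg_nonpos.2 (mul_nonneg (hupos n).le (hT0 w))
    · rw [div_le_iff₀ (hupos n)]
      linarith [Real.add_one_le_exp (-(u n * T w))]
    · have h1 : HasDerivAt (fun x : ℝ => -(x * T w)) (-(1 * T w)) 0 :=
        ((hasDerivAt_id (0 : ℝ)).mul_const (T w)).fun_neg
      have h2 := h1.exp.const_sub 1
      have h3 := h2.tendsto_slope_zero.comp hu
      simp only [zero_mul, neg_zero, Real.exp_zero, one_mul, neg_neg] at h3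
      refine h3.congr fun n => ?_
      simp [div_eq_inv_mul]
    · have h1 : ∀ n, ∫ w, (1 - Real.exp (-(u n * T w))) / u n ∂μ = g (u n) := fun n => by
        rw [integral_div, integral_sub (integrable_const 1) (hiexp n), htr _ (hupos n)]
        have := (hupos n).ne'
        simp
        field_simp
      simp_rw [h1]
      exact hg.continuousAt.tendsto.comp hu0
  refine ⟨hfirst, ?_⟩
  have hi2 : ∀ n, Integrable (fun w => Real.exp (-(u n * T w)) - 1 + u n * T w) μ := fun n =>
    ((hiexp n).sub (integrable_const 1)).add (hfirst.1.const_mul _)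
  refine integrable_and_integral_eq_of_tendsto
    (F := fun n w => 2 * (Real.exp (-(u n * T w)) - 1 + u n * T w) / u n ^ 2)
    (fun n => ((hi2 n).const_mul 2).div_const _) (fun n w => ?_) (fun n w => ?_)
    (fun w => tendsto_exp_neg_second_order _ hu) ?_
  · refine div_nonneg ?_ (sq_nonneg _)
    linarith [Real.add_one_le_exp (-(u n * T w))]
  · have hp := hupos n
    rw [div_le_iff₀ (by positivity)]
    have := exp_neg_le_quadratic (mul_nonneg hp.le (hT0 w))
    linarith [mul_pow (u n) (T w) 2]
  -- Substituting the transform and the first moment turns the second-order quotient into `-2` times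
  -- the difference quotient of `g` at `0`.
  · have h1 : ∀ n, ∫ w, 2 * (Real.exp (-(u n * T w)) - 1 + u n * T w) / u n ^ 2 ∂μ =
        -2 * ((u n)⁻¹ * (g (u n) - g 0)) := fun n => by
      have hi3 : Integrable (fun w => Real.exp (-(u n * T w)) - 1) μ :=
        (hiexp n).sub (integrable_const 1)
      rw [integral_div, integral_const_mul, integral_add hi3 (hfirst.1.const_mul _), integral_sub (hiexp n) (integrable_const 1), integral_const_mul,
        htr _ (hupos n), hfirst.2]
      have := (hupos n).ne'
      simp
      field_simp
      ring
    simp_rw [h1]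
    refine Tendsto.const_mul _ ?_
    have h2 := hg.tendsto_slope_zero.comp hu
    simpa [Function.comp_def] using h2

/-- Brings the transform into the shape required by `moments_of_transform`: its denominator exceeds
its numerator by `σ (W - 1)`, where `W` is the exponential. -/
theorem IsPoissonInput.integral_exp_neg_busyTime {Ω : Type*} [MeasurableSpace Ω] {μ : Measure Ω}
    [IsProbabilityMeasure μ] {lam nu b : ℝ} {X Y : ℕ → Ω → ℝ} (h : IsPoissonInput μ lam nu X Y)
    (hb : 0 ≤ b) {σ : ℝ} (hσ : 0 < σ) :
    ∫ w, Real.exp (-(σ * busyTime nu b X Y w)) ∂μ =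
      1 - σ * ((Real.exp ((lam + nu + σ) * b) - 1) /
        (lam + (nu + σ) * Real.exp ((lam + nu + σ) * b))) := by
  have hlam := h.rate_pos
  have hnu := h.rate_nonneg
  have h1 := h.lst_busyPeriod hb (s := σ) (by simpa using hσ.le)
  have h2 : lst μ (busyPeriod nu b X Y) σ =
      ((∫ w, Real.exp (-(σ * busyTime nu b X Y w)) ∂μ : ℝ) : ℂ) := by
    rw [lst, ← integral_complex_ofReal]
    refine integral_congr_ae ?_
    filter_upwards [h.busyPeriod_ae_eq hb] with w hw
    rw [hw]
    push_cast
    rw [neg_mul]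
  rw [h2] at h1
  have h3 : ((lam : ℂ) + σ + nu * Complex.exp ((lam + σ + nu) * b)) /
      (lam + (σ + nu) * Complex.exp ((lam + σ + nu) * b)) =
      (((lam + σ + nu * Real.exp ((lam + σ + nu) * b)) /
        (lam + (σ + nu) * Real.exp ((lam + σ + nu) * b)) : ℝ) : ℂ) := by
    push_cast; rfl
  rw [h3, Complex.ofReal_inj] at h1
  have h4 : lam + nu + σ = lam + σ + nu := by ring
  rw [h1, h4, add_comm nu σ]
  have hW := Real.exp_pos ((lam + σ + nu) * b)
  generalize Real.exp ((lam + σ + nu) * b) = W at hW ⊢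
  have hD : lam + (σ + nu) * W ≠ 0 := by positivity
  rw [← mul_div_assoc, eq_sub_iff_add_eq, ← add_div, div_eq_one_iff_eq hD]
  ring

theorem IsPoissonInput.moments_busyTime {Ω : Type*} [MeasurableSpace Ω] {μ : Measure Ω}
    [IsProbabilityMeasure μ] {lam nu b : ℝ} {X Y : ℕ → Ω → ℝ} (h : IsPoissonInput μ lam nu X Y)
    (hb : 0 ≤ b) :
    (Integrable (busyTime nu b X Y) μ ∧ ∫ w, busyTime nu b X Y w ∂μ =
        (Real.exp ((lam + nu) * b) - 1) / (lam + nu * Real.exp ((lam + nu) * b))) ∧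
    (Integrable (fun w => busyTime nu b X Y w ^ 2) μ ∧ ∫ w, busyTime nu b X Y w ^ 2 ∂μ =
        2 * (1 - (1 + b * (lam + nu)) * Real.exp (-((lam + nu) * b))) /
          (nu + lam * Real.exp (-((lam + nu) * b))) ^ 2) := by
  have hlam := h.rate_pos
  have hnu := h.rate_nonneg
  have hE := Real.exp_pos ((lam + nu) * b)
  have hD : lam + nu * Real.exp ((lam + nu) * b) ≠ 0 := by positivity
  have he : HasDerivAt (fun σ : ℝ => Real.exp ((lam + nu + σ) * b))
      (Real.exp ((lam + nu) * b) * b) 0 := by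
    have h1 : HasDerivAt (fun σ : ℝ => (lam + nu + σ) * b) (1 * b) 0 :=
      ((hasDerivAt_id (0 : ℝ)).const_add (lam + nu)).mul_const b
    simpa using h1.exp
  have hn : HasDerivAt (fun σ : ℝ => nu + σ) 1 0 := (hasDerivAt_id (0 : ℝ)).const_add nu
  have hg := (he.sub_const 1).fun_div ((hn.fun_mul he).const_add lam) (by simpa using hD)
  have hm := moments_of_transform (measurable_busyTime nu b h.measurable_arrival
    h.measurable_catastrophe) (fun w => ENNReal.toReal_nonneg) hg
    fun σ hσ => h.integral_exp_neg_busyTime hb hσ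
  simp only [add_zero] at hm
  refine ⟨hm.1, hm.2.1, hm.2.2.trans ?_⟩
  rw [Real.exp_neg]
  generalize Real.exp ((lam + nu) * b) = E at hE hD ⊢
  have hD' : nu + lam * E⁻¹ ≠ 0 := by positivity
  have h1 : lam + nu * E = E * (nu + lam * E⁻¹) := by field_simp; ring
  rw [h1]
  field_simp
  ring

end MDInf

theorem mainTheorem11 {Ω : Type*} [MeasurableSpace Ω] (μ : Measure Ω) [IsProbabilityMeasure μ]
    (lam nu b : ℝ) (X Y : ℕ → Ω → ℝ) (h : MDInf.IsPoissonInput μ lam nu X Y) (hb : 0 ≤ b) :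
    -- transform of the idle probability
    (∀ s : ℂ, 0 < s.re →
      IntegrableOn (fun t : ℝ => Complex.exp (-s * t) * (MDInf.idleProb μ nu b X Y t : ℂ))
        (Set.Ioi 0) ∧
      MDInf.idleTransform μ nu b X Y s =
        (lam + (s + nu) * Complex.exp ((lam + s + nu) * b)) /
          (s * (lam + s + nu) * Complex.exp ((lam + s + nu) * b))) ∧
    Tendsto (fun s : ℂ => s * MDInf.idleTransform μ nu b X Y s) (𝓝[{s : ℂ | 0 < s.re}] 0)
      (𝓝 (((nu + lam * Real.exp (-((lam + nu) * b))) / (nu + lam) : ℝ) : ℂ)) ∧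
    -- the busy period is almost surely finite
    (∀ᵐ w ∂μ, (MDInf.emptyTimes nu b X Y w).Nonempty) ∧
    -- Laplace–Stieltjes transforms of the busy period and of the busy cycle
    (∀ s : ℂ, 0 ≤ s.re →
      MDInf.lst μ (MDInf.busyPeriod nu b X Y) s =
        (lam + s + nu * Complex.exp ((lam + s + nu) * b)) /
          (lam + (s + nu) * Complex.exp ((lam + s + nu) * b))) ∧
    (∀ s : ℂ, 0 ≤ s.re →
      MDInf.lst μ (MDInf.busyCycle nu b X Y) s =
        1 - s * (lam + s + nu) * Complex.exp ((lam + s + nu) * b) /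
          ((lam + s) * (lam + (nu + s) * Complex.exp ((lam + s + nu) * b)))) ∧
    -- first and second moments of the busy period
    (Integrable (MDInf.busyPeriod nu b X Y) μ ∧
      ∫ w, MDInf.busyPeriod nu b X Y w ∂μ =
        (Real.exp ((lam + nu) * b) - 1) / (lam + nu * Real.exp ((lam + nu) * b))) ∧
    (Integrable (fun w => MDInf.busyPeriod nu b X Y w ^ 2) μ ∧
      ∫ w, MDInf.busyPeriod nu b X Y w ^ 2 ∂μ =
        2 * (1 - (1 + b * (lam + nu)) * Real.exp (-((lam + nu) * b))) /
          (nu + lam * Real.exp (-((lam + nu) * b))) ^ 2) := by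
  have hae := h.busyPeriod_ae_eq hb
  have hae2 : (fun w => MDInf.busyPeriod nu b X Y w ^ 2) =ᵐ[μ]
      fun w => MDInf.busyTime nu b X Y w ^ 2 := hae.mono fun w hw => by simp only [hw]
  obtain ⟨h1, h2⟩ := h.moments_busyTime hb
  refine ⟨fun s hs => h.idleTransform_eq hb hs, h.tendsto_mul_idleTransform hb,
    (h.ae_isLeast_emptyTimes hb).mono fun w hw => ⟨_, hw.1⟩,
    fun s hs => h.lst_busyPeriod hb hs, fun s hs => h.lst_busyCycle hb hs,
    ⟨h1.1.congr hae.symm, (integral_congr_ae hae).trans h1.2⟩,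
    ⟨h2.1.congr hae2.symm, (integral_congr_ae hae2).trans h2.2⟩⟩
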